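/- Let $R_0$ be a reduced irreducible (crystallographic) root system spanning a real Euclidean space $V_0,(\cdot,\cdot)$, with positive roots $R_0^+$, simple roots $\alpha_1,\dots,\alpha_n$, highest short root $\beta$, and $\alpha^\vee=2\alpha/(\alpha,\alpha)$. Let $P=\{\lambda\in V_0 : (\alpha^\vee,\lambda)\in\mathbb Z\ \forall \alpha\in R_0\}$ be the weight lattice and $\mathcal O=\{\lambda\in P : (\alpha^\vee,\lambda)\in\{0,1\}\ \forall\alpha\in R_0^+\}$. Identify $r\delta+y$ ($r\in\mathbb R$, $y\in V_0$) with the affine linear function $(r\delta+y,x)=r+(y,x)$ on $V_0$, put $a_0=\delta-\beta^\vee$ and $a_i=\alpha_i^\vee$ for $1\le i\le n$, let $s_i$ be the orthogonal reflection of $V_0$ in the hyperplane $(a_i,x)=0$, and let $W$ be the (dual affine Weyl) group generated by $s_0,\dots,s_n$; it acts on $P$. Let $k_\alpha$ ($\alpha\in R_0$) be parameters which depend only on the orbit of $\alpha$ under the finite Weyl group and are otherwise independent indeterminates; put $k_0=k_\beta$, $k_i=k_{\alpha_i}$ for $i\ge1$, $\mathbb F=\mathbb R(k_\alpha)$ and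 $\rho=\frac12\sum_{\alpha\in R_0^+}k_\alpha\alpha$. Let $\mathcal R$ be the $\mathbb F$-span of the exponentials $e^\mu$, $\mu\in P$, on which $W$ acts by $s_ie^\mu=e^{s_i\cdot\mu}$, and for $y\in V_0$ define the Cherednik operator on $\mathcal R$ by $$D_y=\partial_y+\sum_{\alpha\in R_0^+}(y,\alpha)\,k_\alpha\,\frac1{1-e^{-\alpha}}(1-s_\alpha)-(y,\rho),\qquad \partial_y e^\mu=(y,\mu)e^\mu .$$ For $\mu\in P$ put $\widetilde\mu=\mu+\frac12\sum_{\alpha\in R_0^+}k_\alpha\,\varepsilon_{(\alpha^\vee,\mu)}\,\alpha$, where $\varepsilon_t=1$ if $t>0$ and $\varepsilon_t=-1$ if $t\le0$. The nonsymmetric Heckman–Opdam polynomial $E_\mu$ is the unique element of $\mathcal R$ in which the coefficient of $e^\mu$ is $1$ and such that $D_yE_\mu=(y,\widetilde\mu)E_\mu$ for all $y\in V_0$. Let $\lambda\in P$. There is a shortest element $w_\lambda$ of $W$ with $\overline\lambda:=w_\lambda\cdot\lambda\in\mathcal O$. For every reduced expression $w_\lambda=s_{i_1}\cdots s_{i_m}$,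 put $\lambda_{(j)}=s_{i_{j-1}}\cdots s_{i_1}\cdot\overline\lambda$ for $1\le j\le m$. Then $(a_{i_j},\widetilde{\lambda_{(j)}})\ne0$ for all $j$ and, with $c_j=k_{i_j}\,(a_{i_j},\widetilde{\lambda_{(j)}})^{-1}$, $$E_\lambda=(s_{i_m}+c_m)\cdots(s_{i_1}+c_1)\,e^{\overline\lambda}.$$ -/

import Mathlib

open scoped TensorProduct RealInnerProductSpace

noncomputable section

namespace HeckmanOpdam

variable {ι V : Type*} [NormedAddCommGroup V] [InnerProductSpace ℝ V]

/-- A root pairing of a Euclidean space `V` with itself which is the classical one: the pairing is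
the inner product and `α^∨ = 2 α / (α, α)`. -/
class IsEuclidean (P : RootPairing ι ℝ V V) : Prop where
  toLinearMap_eq : P.toLinearMap = innerₗ V
  coroot_eq : ∀ i, P.coroot i = (2 / ⟪P.root i, P.root i⟫) • P.root i

/-- `β` is the highest short root with respect to the base `b`: its length is minimal, and
`β - α` is a sum of simple roots for every root `α` of the same length. -/
def IsHighestShort {P : RootPairing ι ℝ V V} (b : P.Base) (β : ι) : Prop :=
  (∀ j, ‖P.root β‖ ≤ ‖P.root j‖) ∧
  ∀ j, ‖P.root j‖ = ‖P.root β‖ →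
    P.root β - P.root j ∈ AddSubmonoid.closure (P.root '' b.support)

/-! ### The dual affine Weyl group -/

/-- The value at `x` of the affine linear function `a = r δ + y`, represented as `(r, y)`. -/
def affPairing (a : ℝ × V) (x : V) : ℝ := a.1 + ⟪a.2, x⟫

lemma affReflection_aux (a : ℝ × V) : Function.Involutive
    (fun x : V => x - (2 * affPairing a x / ⟪a.2, a.2⟫) • a.2) := by
  intro x
  rcases eq_or_ne a.2 0 with h | h
  · simp [h]
  · have h' : ⟪a.2, a.2⟫ ≠ 0 := by simpa using h
    have : affPairing a (x - (2 * affPairing a x / ⟪a.2, a.2⟫) • a.2) = - affPairing a x := by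
      simp only [affPairing, inner_sub_right, inner_smul_right]
      field_simp
      ring
    simp only [this]
    rw [sub_sub, ← add_smul]
    ring_nf
    simp

/-- The orthogonal reflection of `V` in the affine hyperplane `{x | (a, x) = 0}`. -/
def affReflection (a : ℝ × V) : Equiv.Perm V := (affReflection_aux a).toPerm

/-- The base `a₀ = δ - β^∨`, `aᵢ = αᵢ^∨` of the dual affine root system; the index `none`
stands for `0`, and `some i` for the simple root `αᵢ`. -/
def simpleAff {P : RootPairing ι ℝ V V} (b : P.Base) (β : ι) : Option b.support → ℝ × V
  | none => (1, -P.coroot β)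
  | some i => (0, P.coroot i)

/-- The simple reflections `s₀, …, sₙ`. -/
def simpleRefl {P : RootPairing ι ℝ V V} (b : P.Base) (β : ι) (i : Option b.support) :
    Equiv.Perm V :=
  affReflection (simpleAff b β i)

/-- The dual affine Weyl group `W`. -/
def affineWeylGroup {P : RootPairing ι ℝ V V} (b : P.Base) (β : ι) : Subgroup (Equiv.Perm V) :=
  Subgroup.closure (Set.range (simpleRefl b β))

/-- The element `s_{i₁} ⋯ s_{iₘ}` expressed by a word `i₁, …, iₘ`. -/
def wordProd {P : RootPairing ι ℝ V V} (b : P.Base) (β : ι) (l : List (Option b.support)) :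
    Equiv.Perm V :=
  (l.map (simpleRefl b β)).prod

/-- The length of an element of `W`. -/
def length {P : RootPairing ι ℝ V V} (b : P.Base) (β : ι) (w : Equiv.Perm V) : ℕ :=
  sInf {n | ∃ l : List (Option b.support), l.length = n ∧ wordProd b β l = w}

/-- The word `l` is a reduced expression of `w`. -/
def IsReducedExpression {P : RootPairing ι ℝ V V} (b : P.Base) (β : ι)
    (l : List (Option b.support)) (w : Equiv.Perm V) : Prop :=
  wordProd b β l = w ∧ l.length = length b β w

/-! ### Weights -/

/-- The weight lattice. -/
def weightLattice (P : RootPairing ι ℝ V V) : AddSubgroup V where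
  carrier := {x | ∀ i, ∃ n : ℤ, ⟪P.coroot i, x⟫ = n}
  zero_mem' i := ⟨0, by simp⟩
  add_mem' {x y} hx hy i := by
    obtain ⟨m, hm⟩ := hx i
    obtain ⟨n, hn⟩ := hy i
    exact ⟨m + n, by simp [inner_add_right, hm, hn]⟩
  neg_mem' {x} hx i := by
    obtain ⟨m, hm⟩ := hx i
    exact ⟨-m, by simp [inner_neg_right, hm]⟩

/-- The set `𝒪` of (minuscule) weights `λ` with `(α^∨, λ) ∈ {0, 1}` for all positive roots `α`. -/
def minuscule {P : RootPairing ι ℝ V V} (b : P.Base) : Set V :=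
  {x | x ∈ weightLattice P ∧ ∀ i, b.IsPos i → ⟪P.coroot i, x⟫ = 0 ∨ ⟪P.coroot i, x⟫ = 1}

/-- `w` is a shortest element of `W` such that `w · x ∈ 𝒪`. -/
def IsShortestToMinuscule {P : RootPairing ι ℝ V V} (b : P.Base) (β : ι) (x : V)
    (w : Equiv.Perm V) : Prop :=
  w ∈ affineWeylGroup b β ∧ w x ∈ minuscule b ∧
    ∀ w' ∈ affineWeylGroup b β, w' x ∈ minuscule b → length b β w ≤ length b β w'

section Euclidean

variable (P : RootPairing ι ℝ V V) [IsEuclidean P]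

lemma inner_coroot (i : ι) (x : V) : ⟪P.coroot i, x⟫ = P.coroot' i x := by
  have h : P.toLinearMap x (P.coroot i) = ⟪x, P.coroot i⟫ := by
    rw [IsEuclidean.toLinearMap_eq]; rfl
  rw [real_inner_comm, ← h]; rfl

/-- The reflection attached to `r δ + α^∨`, in terms of the root `α`. -/
lemma affReflection_coroot (r : ℝ) (i : ι) (x : V) :
    affReflection (r, P.coroot i) x = x - (r + ⟪P.coroot i, x⟫) • P.root i := by
  have h0 : P.root i ≠ 0 := P.ne_zero i
  have h' : ⟪P.root i, P.root i⟫ ≠ 0 := by simpa using h0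
  change x - (2 * affPairing (r, P.coroot i) x / ⟪P.coroot i, P.coroot i⟫) • P.coroot i = _
  congr 1
  simp only [affPairing, IsEuclidean.coroot_eq, inner_smul_left, inner_smul_right, smul_smul]
  congr 1
  simp only [conj_trivial]
  field_simp

lemma simpleRefl_some {P : RootPairing ι ℝ V V} [IsEuclidean P] (b : P.Base) (β : ι)
    (i : b.support) (x : V) :
    simpleRefl b β (some i) x = x - ⟪P.coroot i, x⟫ • P.root i := by
  have h := affReflection_coroot P 0 i x
  rw [zero_add] at h
  exact h

lemma simpleRefl_none {P : RootPairing ι ℝ V V} [IsEuclidean P] (b : P.Base) (β : ι) (x : V) :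
    simpleRefl b β none x = x + (1 - ⟪P.coroot β, x⟫) • P.root β := by
  have h := affReflection_coroot P (-1) β x
  have h2 : simpleRefl b β none x = affReflection (-1, P.coroot β) x := by
    change x - (2 * affPairing (1, -P.coroot β) x / ⟪-P.coroot β, -P.coroot β⟫) • -P.coroot β =
      x - (2 * affPairing (-1, P.coroot β) x / ⟪P.coroot β, P.coroot β⟫) • P.coroot β
    simp only [affPairing, inner_neg_left, inner_neg_right, neg_neg, smul_neg, ← neg_smul]
    congr 2
    ring
  rw [h2, h, sub_eq_add_neg, ← neg_smul]
  congr 2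
  ring

variable [P.IsCrystallographic]

lemma root_mem_weightLattice (i : ι) : P.root i ∈ weightLattice P := by
  intro j
  obtain ⟨n, hn⟩ := P.exists_value (S := ℤ) i j
  exact ⟨n, by rw [inner_coroot]; simpa using hn.symm⟩

/-- A root, as a weight. -/
def rootWeight (i : ι) : weightLattice P := ⟨P.root i, root_mem_weightLattice P i⟩

lemma simpleRefl_mem {P : RootPairing ι ℝ V V} [IsEuclidean P] [P.IsCrystallographic]
    (b : P.Base) (β : ι) (i : Option b.support) {x : V} (hx : x ∈ weightLattice P) :
    simpleRefl b β i x ∈ weightLattice P := by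
  cases i with
  | none =>
    obtain ⟨n, hn⟩ := hx β
    rw [simpleRefl_none, hn]
    have : (1 - (n : ℝ)) • P.root β = (1 - n : ℤ) • P.root β := by
      rw [← Int.cast_smul_eq_zsmul ℝ]; push_cast; rfl
    rw [this]
    exact add_mem hx (zsmul_mem (root_mem_weightLattice P β) _)
  | some i =>
    obtain ⟨n, hn⟩ := hx i
    rw [simpleRefl_some, hn, Int.cast_smul_eq_zsmul]
    exact sub_mem hx (zsmul_mem (root_mem_weightLattice P i) _)

/-- The action of `sᵢ` on weights. -/
def reflWeight {P : RootPairing ι ℝ V V} [IsEuclidean P] [P.IsCrystallographic]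
    (b : P.Base) (β : ι) (i : Option b.support) (μ : weightLattice P) : weightLattice P :=
  ⟨simpleRefl b β i μ, simpleRefl_mem b β i μ.2⟩

/-- The integer `(α^∨, μ)`. -/
def intPairing (P : RootPairing ι ℝ V V) (i : ι) (μ : weightLattice P) : ℤ :=
  ⌊⟪P.coroot i, (μ : V)⟫⌋

lemma intPairing_cast (P : RootPairing ι ℝ V V) (i : ι) (μ : weightLattice P) :
    (intPairing P i μ : ℝ) = ⟪P.coroot i, (μ : V)⟫ := by
  obtain ⟨n, hn⟩ := μ.2 i
  simp [intPairing, hn]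

end Euclidean

/-! ### The coefficient field and the group algebra of the weight lattice -/

/-- The parameters: one for each orbit of the Weyl group on the roots. -/
abbrev Param (P : RootPairing ι ℝ V V) : Type _ :=
  MulAction.orbitRel.Quotient P.weylGroupToPerm.range ι

/-- The field `𝔽 = ℝ(k_α)` of rational functions in the parameters. -/
abbrev CoeffField (P : RootPairing ι ℝ V V) : Type _ :=
  FractionRing (MvPolynomial (Param P) ℝ)

/-- The parameter `k_α`, which depends only on the Weyl group orbit of `α`. -/
def param (P : RootPairing ι ℝ V V) (i : ι) : CoeffField P :=
  algebraMap (MvPolynomial (Param P) ℝ) (CoeffField P)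
    (MvPolynomial.X (Quotient.mk (MulAction.orbitRel P.weylGroupToPerm.range ι) i))

/-- `k₀ = k_β`, and `kᵢ = k_{αᵢ}` for `i ≥ 1`. -/
def simpleParam {P : RootPairing ι ℝ V V} (b : P.Base) (β : ι) :
    Option b.support → CoeffField P
  | none => param P β
  | some i => param P i

/-- The space `ℛ` spanned over `𝔽` by the exponentials `e^μ` of weights. -/
abbrev ExpAlgebra (P : RootPairing ι ℝ V V) : Type _ :=
  AddMonoidAlgebra (CoeffField P) (weightLattice P)

/-- The exponential `e^μ`. -/
def expo {P : RootPairing ι ℝ V V} (μ : weightLattice P) : ExpAlgebra P :=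
  AddMonoidAlgebra.single μ 1

/-- The `𝔽`-linear operator on `ℛ` with prescribed values on the exponentials. -/
def linExt {P : RootPairing ι ℝ V V} (φ : weightLattice P → ExpAlgebra P) :
    Module.End (CoeffField P) (ExpAlgebra P) :=
  Finsupp.linearCombination (CoeffField P) φ ∘ₗ
    (AddMonoidAlgebra.coeffLinearEquiv (CoeffField P)).toLinearMap

@[simp] lemma linExt_expo {P : RootPairing ι ℝ V V} (φ : weightLattice P → ExpAlgebra P)
    (μ : weightLattice P) : linExt φ (expo μ) = φ μ := by
  simp [linExt, expo]

/-- The action of `sᵢ` on `ℛ`, with `sᵢ e^μ = e^{sᵢ · μ}`. -/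
def reflOp {P : RootPairing ι ℝ V V} [IsEuclidean P] [P.IsCrystallographic]
    (b : P.Base) (β : ι) (i : Option b.support) : Module.End (CoeffField P) (ExpAlgebra P) :=
  linExt fun μ => expo (reflWeight b β i μ)

/-! ### Cherednik operators -/

section Cherednik

variable (P : RootPairing ι ℝ V V) [IsEuclidean P] [P.IsCrystallographic]

/-- The action on `ℛ` of the reflection `s_α` in a root, `s_α e^μ = e^{μ - (α^∨, μ) α}`. -/
def rootReflOp (i : ι) : Module.End (CoeffField P) (ExpAlgebra P) :=
  linExt fun μ => expo (μ - intPairing P i μ • rootWeight P i)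

/-- The operator `(1 - e^{-α})⁻¹ (1 - s_α)` on `ℛ`. For `n = (α^∨, μ)` it maps `e^μ` to
`e^μ + e^{μ - α} + ⋯ + e^{μ - (n - 1) α}` if `n ≥ 0`, and to
`-(e^{μ + α} + ⋯ + e^{μ - n α})` if `n ≤ 0`. -/
def divDiff (i : ι) : Module.End (CoeffField P) (ExpAlgebra P) :=
  linExt fun μ =>
    ∑ j ∈ Finset.range (intPairing P i μ).toNat, expo (μ - j • rootWeight P i) -
    ∑ j ∈ Finset.range (-intPairing P i μ).toNat, expo (μ + (j + 1) • rootWeight P i)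

lemma expo_mul {P : RootPairing ι ℝ V V} (μ ν : weightLattice P) :
    expo μ * expo ν = expo (μ + ν) := by
  simp [expo, AddMonoidAlgebra.single_mul_single]

/-- The defining property of `divDiff`. -/
lemma one_sub_mul_divDiff (i : ι) (f : ExpAlgebra P) :
    (1 - expo (-rootWeight P i)) * divDiff P i f = f - rootReflOp P i f := by
  suffices h : LinearMap.mulLeft (CoeffField P) (1 - expo (-rootWeight P i)) ∘ₗ divDiff P i =
      1 - rootReflOp P i by simpa using LinearMap.congr_fun h f
  have key : ∀ (α μ : weightLattice P) (n : ℕ),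
      (1 - expo (-α)) * ∑ j ∈ Finset.range n, expo (μ - j • α) = expo μ - expo (μ - n • α) := by
    intro α μ n
    induction n with
    | zero => simp
    | succ n ih =>
      rw [Finset.sum_range_succ, mul_add, ih, sub_mul, one_mul, expo_mul, succ_nsmul]
      rw [show -α + (μ - n • α) = μ - (n • α + α) by abel]
      abel
  have key' : ∀ (α μ : weightLattice P) (n : ℕ),
      (1 - expo (-α)) * ∑ j ∈ Finset.range n, expo (μ + (j + 1) • α) =
        expo (μ + n • α) - expo μ := by
    intro α μ n
    induction n with
    | zero => simp
    | succ n ih =>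
      rw [Finset.sum_range_succ, mul_add, ih, sub_mul, one_mul, expo_mul]
      rw [show -α + (μ + (n + 1) • α) = μ + n • α by rw [succ_nsmul]; abel]
      abel
  ext1
  refine LinearMap.ext_ring ?_
  change (1 - expo (-rootWeight P i)) * divDiff P i (expo _) = expo _ - rootReflOp P i (expo _)
  rw [divDiff, rootReflOp, linExt_expo, linExt_expo, mul_sub, key, key']
  generalize intPairing P i _ = n
  rcases Int.eq_nat_or_neg n with ⟨m, rfl | rfl⟩ <;> simp

/-- The derivative `∂_y`, with `∂_y e^μ = (y, μ) e^μ`. -/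
def dirDeriv (P : RootPairing ι ℝ V V) (y : V) : Module.End (CoeffField P) (ExpAlgebra P) :=
  linExt fun μ => algebraMap ℝ (CoeffField P) ⟪y, (μ : V)⟫ • expo μ

/-- The pairing `(y, ·)` with `y ∈ V`, extended linearly to `𝔽 ⊗ V`. -/
def pairingExt (P : RootPairing ι ℝ V V) (y : V) :
    (CoeffField P ⊗[ℝ] V) →ₗ[CoeffField P] CoeffField P :=
  (TensorProduct.AlgebraTensorModule.rid ℝ (CoeffField P) (CoeffField P)).toLinearMap ∘ₗ
    (innerₗ V y).baseChange (CoeffField P)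

@[simp] lemma pairingExt_tmul (P : RootPairing ι ℝ V V) (y v : V) (c : CoeffField P) :
    pairingExt P y (c ⊗ₜ v) = c * algebraMap ℝ (CoeffField P) ⟪y, v⟫ := by
  simp [pairingExt, Algebra.smul_def, mul_comm]

/-- The value `(a, x)` of the affine linear function `a = r δ + y` at a point `x` of `𝔽 ⊗ V`. -/
def affPairingExt (P : RootPairing ι ℝ V V) (a : ℝ × V) (x : CoeffField P ⊗[ℝ] V) :
    CoeffField P :=
  algebraMap ℝ (CoeffField P) a.1 + pairingExt P a.2 x

variable {P} [Fintype ι] (b : P.Base)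

/-- The positive roots. -/
def posRoots {P : RootPairing ι ℝ V V} (b : P.Base) : Finset ι :=
  letI : DecidablePred b.IsPos := Classical.decPred _
  Finset.univ.filter b.IsPos

/-- `ρ = ½ ∑_{α > 0} k_α α`. -/
def rho {P : RootPairing ι ℝ V V} (b : P.Base) : CoeffField P ⊗[ℝ] V :=
  (1 / 2 : CoeffField P) • ∑ i ∈ posRoots b, param P i ⊗ₜ P.root i

/-- The Cherednik operator
`D_y = ∂_y + ∑_{α > 0} (y, α) k_α (1 - e^{-α})⁻¹ (1 - s_α) - (y, ρ)`. -/
def cherednik (y : V) : Module.End (CoeffField P) (ExpAlgebra P) :=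
  dirDeriv P y +
    ∑ i ∈ posRoots b,
      (algebraMap ℝ (CoeffField P) ⟪y, P.root i⟫ * param P i) • divDiff P i -
    pairingExt P y (rho b) • 1

/-- `ε_t` is `1` if `t > 0`, and `-1` if `t ≤ 0`. -/
def eps (n : ℤ) : ℤ := if 0 < n then 1 else -1

/-- `λ̃ = λ + ½ ∑_{α > 0} k_α ε_{(α^∨, λ)} α`. -/
def tilde {P : RootPairing ι ℝ V V} (b : P.Base) (μ : weightLattice P) : CoeffField P ⊗[ℝ] V :=
  1 ⊗ₜ (μ : V) + (1 / 2 : CoeffField P) •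
    ∑ i ∈ posRoots b, (param P i * (eps (intPairing P i μ) : CoeffField P)) ⊗ₜ P.root i

/-- `f` is the nonsymmetric Heckman–Opdam polynomial `E_μ`: the coefficient of `e^μ` in `f` is `1`,
and `D_y f = (y, μ̃) f` for all `y ∈ V`. -/
def IsNonsymmetricHeckmanOpdam (μ : weightLattice P) (f : ExpAlgebra P) : Prop :=
  f.coeff μ = 1 ∧ ∀ y : V, cherednik b y f = pairingExt P y (tilde b μ) • f

/-! ### The product formula -/

/-- For the word `l = i₁, …, iₘ` and `j = 0, …, m - 1`, the weight
`λ_(j+1) = s_{i_j} ⋯ s_{i₁} · ν`. -/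
def partialWeight (β : ι) (l : List (Option b.support)) (ν : weightLattice P) (j : ℕ) :
    weightLattice P :=
  (l.take j).foldl (fun μ i => reflWeight b β i μ) ν

/-- The denominator `(a_{i_j}, (λ_(j))~)` of `c_j`, where `j = 1, …, m` is shifted to
`0, …, m - 1`. -/
def denom (β : ι) (l : List (Option b.support)) (ν : weightLattice P) (j : Fin l.length) :
    CoeffField P :=
  affPairingExt P (simpleAff b β (l.get j)) (tilde b (partialWeight b β l ν j))

/-- `c_j = k_{i_j} (a_{i_j}, (λ_(j))~)⁻¹`. -/
def coef (β : ι) (l : List (Option b.support)) (ν : weightLattice P) (j : Fin l.length) :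
    CoeffField P :=
  simpleParam b β (l.get j) * (denom b β l ν j)⁻¹

/-- `(s_{iₘ} + cₘ) ⋯ (s_{i₁} + c₁) e^ν`. -/
def intertwinerProduct (β : ι) (l : List (Option b.support)) (ν : weightLattice P) :
    ExpAlgebra P :=
  (List.ofFn fun j : Fin l.length => reflOp b β (l.get j) + coef b β l ν j • 1).reverse.prod
    (expo ν)

end Cherednik

end HeckmanOpdam

end

open HeckmanOpdam

noncomputable section

set_option linter.unusedSectionVars false

namespace HeckmanOpdam

variable {ι V : Type*} [NormedAddCommGroup V] [InnerProductSpace ℝ V]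

/-! ### Euclidean geometry of the highest short root. -/

section Geometry

variable {P : RootPairing ι ℝ V V}

/-! The operators `sᵢ + kᵢ (aᵢ, μ̃)⁻¹` are intertwiners. The commutation relation `cherednik_reflOp`
moves `D_y` past `sᵢ` at the cost of replacing `y` by `s_θ y`, where `s_θ` is the linear part of
`sᵢ`, and of adding a multiple of `sᵢ` and one of the identity. On a joint eigenvector for `μ̃` with
`(aᵢ, μ) ≠ 0`, the added constant is exactly what cancels the identity term, and a joint eigenvector
for the tilde of `sᵢ μ` results (`cherednik_intertwiner`). The denominator is nonzero because it
specializes to `(aᵢ, μ)` at `k = 0` (`wallValueExt_ne_zero`). For `ν ∈ 𝒪` the exponential `e^ν` is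
itself an eigenvector (`cherednik_expo_of_minuscule`).

The affine reflection `s₀` is no harder than the finite ones because `(α^∨, β) ∈ {0, 1}` for every
positive `α ≠ β`. Hence, up to sign, each `sᵢ` permutes the positive roots other than `θ`, and it
changes the coordinates `n = (α^∨, μ)` only by this permutation and by flips `n ↦ 1 - n`. The level,
the divided differences and `ε` all behave simply under these flips.

Normalization and nonvanishing come from the level. A simple reflection changes it by the sign of
`(aᵢ, μ)`, and it vanishes exactly on `𝒪`. Outside `𝒪` some reflection lowers it, which rests on
`IsHighestShort.inner_coroot_le`. So the length of `w_λ` is the level of `λ`, and along a reduced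
expression every letter raises the level by one (`level_eq_length_of_isReducedExpression`). The
leading coefficient therefore stays `1` and no denominator vanishes
(`IsLevelTriangular.intertwiner`).

Uniqueness is a Nakayama argument at `k = 0`, where `D_y` becomes `∂_y` and the weights are
separated (`eq_zero_of_coeff_eq_zero`); no triangularity of `D_y` is needed. -/

lemma root_reflectionPerm_self (i : ι) : P.root (P.reflectionPerm i i) = -P.root i := by simp

lemma coroot_reflectionPerm_self (i : ι) : P.coroot (P.reflectionPerm i i) = -P.coroot i := by simp

lemma isPos_reflectionPerm_self (b : P.Base) (i : ι) :
    b.IsPos (P.reflectionPerm i i) ↔ ¬ b.IsPos i :=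
  RootPairing.Base.IsPos.neg_iff_not b i

lemma reflectionPerm_reflectionPerm_self (i j : ι) :
    P.reflectionPerm i (P.reflectionPerm j j) =
      P.reflectionPerm (P.reflectionPerm i j) (P.reflectionPerm i j) := by
  apply P.root.injective
  rw [root_reflectionPerm_self]
  simp [RootPairing.root_reflectionPerm]

variable [IsEuclidean P]

lemma inner_root_root_pos (i : ι) : 0 < ⟪P.root i, P.root i⟫ :=
  real_inner_self_pos.2 (P.ne_zero i)

lemma inner_coroot_eq (i : ι) (x : V) :
    ⟪P.coroot i, x⟫ = 2 / ⟪P.root i, P.root i⟫ * ⟪P.root i, x⟫ := by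
  rw [IsEuclidean.coroot_eq, inner_smul_left]; rfl

lemma inner_coroot_root (i j : ι) : ⟪P.coroot i, P.root j⟫ = P.pairing j i := by
  rw [inner_coroot]; rfl

lemma inner_coroot_self (i : ι) : ⟪P.coroot i, P.root i⟫ = 2 := by
  rw [inner_coroot_root]; simp

lemma inner_coroot_nonneg {i : ι} {x : V} : 0 ≤ ⟪P.coroot i, x⟫ ↔ 0 ≤ ⟪P.root i, x⟫ := by
  rw [inner_coroot_eq]
  exact mul_nonneg_iff_of_pos_left (div_pos two_pos (inner_root_root_pos i))

lemma inner_root_nonneg_of_isPos {b : P.Base} {i : ι} (hi : b.IsPos i) [Finite ι]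
    [P.IsCrystallographic] {x : V} (hx : ∀ j ∈ b.support, 0 ≤ ⟪P.root j, x⟫) :
    0 ≤ ⟪P.root i, x⟫ := by
  refine hi.induction_on_add (p := fun i => 0 ≤ ⟪P.root i, x⟫) hx ?_
  intro i j k hk hi hj
  rw [hk, inner_add_left]
  exact add_nonneg hi (hx j hj)

lemma root_reflectionPerm_eq (i j : ι) :
    P.root (P.reflectionPerm i j) = P.root j - ⟪P.coroot i, P.root j⟫ • P.root i := by
  rw [inner_coroot_root, RootPairing.root_reflectionPerm, RootPairing.reflection_apply_root]

lemma coroot_reflectionPerm_eq (i j : ι) :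
    P.coroot (P.reflectionPerm i j) = P.coroot j - ⟪P.coroot j, P.root i⟫ • P.coroot i := by
  rw [inner_coroot_root, RootPairing.coroot_reflectionPerm, RootPairing.coreflection_apply_coroot]

/-- A linear functional extending the height. -/
lemma exists_height_functional [P.IsRootSystem] (b : P.Base) :
    ∃ φ : V →ₗ[ℝ] ℝ, ∀ i, φ (P.root i) = b.height i := by
  refine ⟨b.toWeightBasis.constr ℝ (fun _ => (1 : ℝ)), fun i => ?_⟩
  have h1 : ∀ j ∈ b.support, b.toWeightBasis.constr ℝ (fun _ => (1 : ℝ)) (P.root j) = 1 := by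
    intro j hj
    have := b.toWeightBasis.constr_basis ℝ (fun _ => (1 : ℝ)) ⟨j, hj⟩
    simpa using this
  obtain ⟨f, -, -, hf⟩ := b.exists_root_eq_sum_int i
  rw [RootPairing.Base.height_eq_sum hf, hf, map_sum]
  push_cast
  refine Finset.sum_congr rfl fun j hj => ?_
  rw [map_zsmul, h1 j hj]; simp

lemma height_functional_nonneg {b : P.Base} {φ : V →ₗ[ℝ] ℝ}
    (hφ : ∀ i, φ (P.root i) = b.height i) {x : V}
    (hx : x ∈ AddSubmonoid.closure (P.root '' b.support)) : 0 ≤ φ x := by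
  induction hx using AddSubmonoid.closure_induction with
  | mem x hx =>
    obtain ⟨j, hj, rfl⟩ := hx
    rw [hφ, RootPairing.Base.height_one_of_mem_support hj]; simp
  | zero => simp
  | add x y _ _ hx hy => rw [map_add]; exact add_nonneg hx hy

lemma norm_root_reflectionPerm (i j : ι) :
    ‖P.root (P.reflectionPerm i j)‖ = ‖P.root j‖ := by
  have h : ‖P.root (P.reflectionPerm i j)‖ ^ 2 = ‖P.root j‖ ^ 2 := by
    rw [← real_inner_self_eq_norm_sq, ← real_inner_self_eq_norm_sq, root_reflectionPerm_eq,
      inner_coroot_eq]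
    simp only [inner_sub_left, inner_sub_right, inner_smul_left, inner_smul_right, conj_trivial,
      real_inner_comm (P.root i) (P.root j)]
    have := (inner_root_root_pos (P := P) i).ne'
    field_simp
    ring
  exact (sq_eq_sq₀ (norm_nonneg _) (norm_nonneg _)).1 h

section HighestShort

variable [P.IsRootSystem] {b : P.Base} {β : ι}

/-- Compare `β` with `-β`, which has the same length: `2β` has nonnegative height. -/
lemma IsHighestShort.isPos (hβ : IsHighestShort b β) : b.IsPos β := by
  obtain ⟨φ, hφ⟩ := exists_height_functional b
  have h := height_functional_nonneg hφ (hβ.2 (P.reflectionPerm β β)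
    (norm_root_reflectionPerm β β))
  rw [root_reflectionPerm_self, sub_neg_eq_add, map_add, hφ, ← two_mul] at h
  rw [RootPairing.Base.isPos_iff']
  have : (0 : ℝ) ≤ b.height β := by linarith
  exact_mod_cast this

/-- Compare `β` with `s_j β`: their difference is `(α_j^∨, β) α_j`, which must have nonnegative
height. -/
lemma IsHighestShort.inner_simple_nonneg (hβ : IsHighestShort b β) {j : ι} (hj : j ∈ b.support) :
    0 ≤ ⟪P.root j, P.root β⟫ := by
  obtain ⟨φ, hφ⟩ := exists_height_functional b
  have h := height_functional_nonneg hφ (hβ.2 (P.reflectionPerm j β)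
    (norm_root_reflectionPerm j β))
  rw [root_reflectionPerm_eq, sub_sub_cancel, map_smul, hφ,
    RootPairing.Base.height_one_of_mem_support hj] at h
  simpa [inner_coroot_nonneg] using h

variable [Finite ι] [P.IsCrystallographic]

lemma IsHighestShort.inner_nonneg (hβ : IsHighestShort b β) {i : ι} (hi : b.IsPos i) :
    0 ≤ ⟪P.root i, P.root β⟫ :=
  inner_root_nonneg_of_isPos hi fun _ hj => hβ.inner_simple_nonneg hj

lemma exists_int_inner_coroot_root (i j : ι) : ∃ n : ℤ, ⟪P.coroot i, P.root j⟫ = n :=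
  root_mem_weightLattice P j i

/-- A value of at least `2` would mean `(α, α) ≤ (α, β)`; as `β` has minimal length, this gives `‖α
- β‖² ≤ 0`. -/
lemma IsHighestShort.inner_coroot_eq_zero_or_one (hβ : IsHighestShort b β) {i : ι}
    (hi : 0 ≤ ⟪P.root i, P.root β⟫) (hiβ : i ≠ β) :
    ⟪P.coroot i, P.root β⟫ = 0 ∨ ⟪P.coroot i, P.root β⟫ = 1 := by
  obtain ⟨n, hn⟩ := exists_int_inner_coroot_root (P := P) i β
  have h0 : (0 : ℝ) ≤ n := hn ▸ inner_coroot_nonneg.2 hi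
  have h2 : n < 2 := by
    by_contra! h2
    have h2 : (2 : ℝ) ≤ n := by exact_mod_cast h2
    rw [← hn, inner_coroot_eq] at h2
    have hp := inner_root_root_pos (P := P) i
    rw [div_mul_eq_mul_div, le_div_iff₀ hp] at h2
    have h3 : ‖P.root i - P.root β‖ ^ 2 ≤ 0 := by
      rw [norm_sub_sq_real]
      have h4 : ‖P.root β‖ ^ 2 ≤ ‖P.root i‖ ^ 2 := pow_le_pow_left₀ (norm_nonneg _) (hβ.1 i) 2
      rw [real_inner_self_eq_norm_sq] at h2
      linarith
    have h5 : ‖P.root i - P.root β‖ = 0 := by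
      have := norm_nonneg (P.root i - P.root β)
      nlinarith
    exact hiβ (P.root.injective (sub_eq_zero.1 (norm_eq_zero.1 h5)))
  have h0 : 0 ≤ n := by exact_mod_cast h0
  rw [hn]
  interval_cases n <;> simp

/-- `s_β` negates the inner product with `β`, which is nonnegative on positive roots. -/
lemma IsHighestShort.not_isPos_reflectionPerm (hβ : IsHighestShort b β) {i : ι}
    (hi : 0 < ⟪P.root i, P.root β⟫) : ¬ b.IsPos (P.reflectionPerm β i) := by
  intro h
  have h1 := hβ.inner_nonneg h
  rw [root_reflectionPerm_eq, inner_sub_left, inner_smul_left, conj_trivial, inner_coroot_eq,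
    real_inner_comm (P.root i)] at h1
  have := inner_root_root_pos (P := P) β
  field_simp at h1
  linarith

end HighestShort

/-- The inner product as an invariant form. -/
def innerForm (P : RootPairing ι ℝ V V) [IsEuclidean P] : P.InvariantForm where
  form := innerₗ V
  symm := ⟨fun x y => real_inner_comm y x⟩
  ne_zero i := (inner_root_root_pos i).ne'
  isOrthogonal_reflection i := by
    intro x y
    change ⟪P.reflection i x, P.reflection i y⟫ = ⟪x, y⟫
    rw [RootPairing.reflection_apply, RootPairing.reflection_apply, ← inner_coroot, ← inner_coroot,
      inner_coroot_eq, inner_coroot_eq]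
    simp only [inner_sub_left, inner_sub_right, inner_smul_left, inner_smul_right, conj_trivial,
      real_inner_comm (P.root i) x]
    have := (inner_root_root_pos (P := P) i).ne'
    field_simp
    ring

variable [P.IsRootSystem] [Finite ι] [P.IsCrystallographic] [P.IsIrreducible]
  {b : P.Base} {β : ι}

/-- By irreducibility some root of the length of `β` is not orthogonal to the dominant root `α`; it
or its negative pairs positively with `α`, and `β` pairs at least as much. -/
lemma IsHighestShort.inner_pos (hβ : IsHighestShort b β) {i : ι}
    (hi : ∀ j ∈ b.support, 0 ≤ ⟪P.root j, P.root i⟫) : 0 < ⟪P.root i, P.root β⟫ := by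
  have hcl : ∀ x ∈ AddSubmonoid.closure (P.root '' b.support), 0 ≤ ⟪P.root i, x⟫ := by
    intro x hx
    induction hx using AddSubmonoid.closure_induction with
    | mem x hx =>
      obtain ⟨j, hj, rfl⟩ := hx
      rw [real_inner_comm]; exact hi j hj
    | zero => simp
    | add x y _ _ hx hy => rw [inner_add_right]; exact add_nonneg hx hy
  have key : ∀ k, ‖P.root k‖ = ‖P.root β‖ → ⟪P.root i, P.root k⟫ ≤ ⟪P.root i, P.root β⟫ := by
    intro k hk
    have := hcl _ (hβ.2 k hk)
    rw [inner_sub_right] at this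
    linarith
  obtain ⟨k, hk, hne⟩ := P.exists_form_eq_form_and_form_ne_zero (innerForm P) i β
  change ⟪P.root k, P.root k⟫ = ⟪P.root β, P.root β⟫ at hk
  change ⟪P.root i, P.root k⟫ ≠ 0 at hne
  rw [real_inner_self_eq_norm_sq, real_inner_self_eq_norm_sq,
    sq_eq_sq₀ (norm_nonneg _) (norm_nonneg _)] at hk
  have h1 := key k hk
  have h2 := key (P.reflectionPerm k k) ((norm_root_reflectionPerm k k).trans hk)
  rw [root_reflectionPerm_self, inner_neg_right] at h2
  rcases lt_or_gt_of_ne hne with h | h <;> linarith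

/-- On dominant vectors, `β^∨` dominates all coroots. -/
lemma IsHighestShort.inner_coroot_le (hβ : IsHighestShort b β) {x : V}
    (hx : ∀ j ∈ b.support, 0 ≤ ⟪P.root j, x⟫) (i : ι) :
    ⟪P.coroot i, x⟫ ≤ ⟪P.coroot β, x⟫ := by
  have := Fintype.ofFinite ι
  -- Several coroots may attain the maximum on `x`; breaking ties by the height of the root forces
  -- the chosen root to be dominant.
  obtain ⟨m, -, hm⟩ := Finset.exists_max_image Finset.univ
    (fun k => toLex (⟪P.coroot k, x⟫, b.height k)) ⟨i, Finset.mem_univ i⟩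
  have hmi : ⟪P.coroot i, x⟫ ≤ ⟪P.coroot m, x⟫ := by
    have := hm i (Finset.mem_univ i)
    rw [Prod.Lex.le_iff] at this
    rcases this with h | h
    · exact h.le
    · exact h.1.le
  refine hmi.trans ?_
  -- Otherwise `s_j` would strictly raise the height of the root without lowering the value of its
  -- coroot on `x`.
  have hdom : ∀ j ∈ b.support, 0 ≤ ⟪P.root j, P.root m⟫ := by
    intro j hj
    by_contra! hneg
    have h1 : ⟪P.coroot j, P.root m⟫ < 0 := by
      rw [← not_le, inner_coroot_nonneg, not_le]; exact hneg
    have h2 : ⟪P.coroot m, P.root j⟫ < 0 := by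
      rw [← not_le, inner_coroot_nonneg, not_le, real_inner_comm]; exact hneg
    obtain ⟨n, hn⟩ := exists_int_inner_coroot_root (P := P) j m
    have hht : b.height (P.reflectionPerm j m) = b.height m + (-n) • b.height j := by
      apply b.height_add_zsmul
      rw [root_reflectionPerm_eq, hn, neg_smul, Int.cast_smul_eq_zsmul, sub_eq_add_neg]
    rw [RootPairing.Base.height_one_of_mem_support hj] at hht
    have hn0 : n < 0 := by rw [hn] at h1; exact_mod_cast h1
    have h3 := hm (P.reflectionPerm j m) (Finset.mem_univ _)
    rw [Prod.Lex.le_iff] at h3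
    simp only [ofLex_toLex] at h3
    rw [coroot_reflectionPerm_eq, inner_sub_left, inner_smul_left, conj_trivial] at h3
    have h4 := mul_nonpos_of_nonpos_of_nonneg h2.le (inner_coroot_nonneg.2 (hx j hj))
    rcases h3 with h3 | h3
    · linarith
    · have := h3.2
      rw [hht] at this
      simp at this
      omega
  have hpos := hβ.inner_pos hdom
  by_cases hmβ : m = β
  · rw [hmβ]
  have h1 : ⟪P.coroot m, P.root β⟫ = 1 := by
    rcases hβ.inner_coroot_eq_zero_or_one hpos.le hmβ with h | h
    · rw [inner_coroot_eq] at h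
      exact absurd h (mul_pos (div_pos two_pos (inner_root_root_pos m)) hpos).ne'
    · exact h
  -- The root `-s_β α_m` is positive and its coroot is `β^∨ - α_m^∨`, which is therefore nonnegative
  -- on `x`.
  have h2 := hβ.not_isPos_reflectionPerm hpos
  rw [← isPos_reflectionPerm_self] at h2
  have h3 := inner_coroot_nonneg.2 (inner_root_nonneg_of_isPos h2 hx)
  rw [coroot_reflectionPerm_self, coroot_reflectionPerm_eq, h1, one_smul, neg_sub,
    inner_sub_left] at h3
  linarith

end Geometry

/-! ### Simple affine reflections, the level of a weight, and reduced words. -/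

section Combinatorics

variable {P : RootPairing ι ℝ V V} [IsEuclidean P] [P.IsCrystallographic]

lemma intPairing_eq_iff {i : ι} {μ : weightLattice P} {n : ℤ} :
    intPairing P i μ = n ↔ ⟪P.coroot i, (μ : V)⟫ = n := by
  rw [← intPairing_cast, Int.cast_inj]

lemma intPairing_add (i : ι) (μ ν : weightLattice P) :
    intPairing P i (μ + ν) = intPairing P i μ + intPairing P i ν := by
  rw [intPairing_eq_iff, Int.cast_add, intPairing_cast, intPairing_cast, ← inner_add_right]; rfl

lemma intPairing_neg (i : ι) (μ : weightLattice P) :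
    intPairing P i (-μ) = -intPairing P i μ := by
  rw [intPairing_eq_iff, Int.cast_neg, intPairing_cast, ← inner_neg_right]; rfl

lemma intPairing_sub (i : ι) (μ ν : weightLattice P) :
    intPairing P i (μ - ν) = intPairing P i μ - intPairing P i ν := by
  rw [sub_eq_add_neg, intPairing_add, intPairing_neg, sub_eq_add_neg]

lemma intPairing_zsmul (i : ι) (n : ℤ) (μ : weightLattice P) :
    intPairing P i (n • μ) = n * intPairing P i μ := by
  rw [intPairing_eq_iff, Int.cast_mul, intPairing_cast, AddSubgroup.coe_zsmul,
    ← Int.cast_smul_eq_zsmul ℝ, inner_smul_right]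

lemma intPairing_self (i : ι) : intPairing P i (rootWeight P i) = 2 := by
  rw [intPairing_eq_iff]; exact_mod_cast inner_coroot_self i

lemma intPairing_reflectionPerm (i j : ι) (μ : weightLattice P) :
    intPairing P (P.reflectionPerm i j) μ =
      intPairing P j μ - intPairing P j (rootWeight P i) * intPairing P i μ := by
  rw [intPairing_eq_iff, coroot_reflectionPerm_eq, inner_sub_left, inner_smul_left, conj_trivial]
  push_cast
  simp only [intPairing_cast]
  rfl

lemma intPairing_reflectionPerm_self (i : ι) (μ : weightLattice P) :
    intPairing P (P.reflectionPerm i i) μ = -intPairing P i μ := by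
  rw [intPairing_reflectionPerm, intPairing_self]; ring

lemma rootWeight_reflectionPerm (i j : ι) :
    rootWeight P (P.reflectionPerm i j) =
      rootWeight P j - intPairing P i (rootWeight P j) • rootWeight P i := by
  apply Subtype.ext
  rw [AddSubgroup.coe_sub, AddSubgroup.coe_zsmul, ← Int.cast_smul_eq_zsmul ℝ, intPairing_cast]
  exact root_reflectionPerm_eq i j

lemma rootWeight_reflectionPerm_self (i : ι) :
    rootWeight P (P.reflectionPerm i i) = -rootWeight P i :=
  Subtype.ext (root_reflectionPerm_self i)

/-- The root `θ` for which the linear part of `sᵢ` is `s_θ`. -/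
def gradRoot (b : P.Base) (β : ι) : Option b.support → ι
  | none => β
  | some i => i

/-- The number `e` for which the translation part of `sᵢ` is `e θ`. -/
def shift (b : P.Base) : Option b.support → ℤ
  | none => 1
  | some _ => 0

/-- The integer `(aᵢ, μ)`. -/
def wallValue (b : P.Base) (β : ι) (i : Option b.support) (μ : weightLattice P) : ℤ :=
  match i with
  | none => 1 - intPairing P β μ
  | some j => intPairing P j μ

variable (b : P.Base) (β : ι)

lemma simpleRefl_apply (i : Option b.support) (x : V) :
    simpleRefl b β i x =
      x - (⟪P.coroot (gradRoot b β i), x⟫ - shift b i) • P.root (gradRoot b β i) := by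
  cases i with
  | none =>
    rw [simpleRefl_none, sub_eq_add_neg x, ← neg_smul, neg_sub]
    simp [shift, gradRoot]
  | some i => rw [simpleRefl_some]; simp [shift, gradRoot]

lemma reflWeight_eq (i : Option b.support) (μ : weightLattice P) :
    reflWeight b β i μ =
      μ - (intPairing P (gradRoot b β i) μ - shift b i) • rootWeight P (gradRoot b β i) := by
  apply Subtype.ext
  rw [AddSubgroup.coe_sub, AddSubgroup.coe_zsmul, ← Int.cast_smul_eq_zsmul ℝ, Int.cast_sub,
    intPairing_cast]
  exact simpleRefl_apply b β i μ

lemma simpleRefl_simpleRefl (i : Option b.support) (x : V) :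
    simpleRefl b β i (simpleRefl b β i x) = x :=
  affReflection_aux (simpleAff b β i) x

lemma simpleRefl_mul_self (i : Option b.support) : simpleRefl b β i * simpleRefl b β i = 1 :=
  Equiv.ext (simpleRefl_simpleRefl b β i)

lemma reflWeight_reflWeight (i : Option b.support) (μ : weightLattice P) :
    reflWeight b β i (reflWeight b β i μ) = μ :=
  Subtype.ext (simpleRefl_simpleRefl b β i μ)

lemma intPairing_reflWeight (i : Option b.support) (μ : weightLattice P) (j : ι) :
    intPairing P j (reflWeight b β i μ) =
      intPairing P (P.reflectionPerm (gradRoot b β i) j) μ +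
        shift b i * intPairing P j (rootWeight P (gradRoot b β i)) := by
  rw [reflWeight_eq, intPairing_sub, intPairing_zsmul, intPairing_reflectionPerm]
  ring

lemma intPairing_gradRoot_reflWeight (i : Option b.support) (μ : weightLattice P) :
    intPairing P (gradRoot b β i) (reflWeight b β i μ) =
      2 * shift b i - intPairing P (gradRoot b β i) μ := by
  rw [intPairing_reflWeight, intPairing_self, intPairing_reflectionPerm_self]
  ring

open Classical in
/-- The positive one of the roots `± s_θ α`. -/
def foldRoot (i : Option b.support) (j : ι) : ι :=
  if b.IsPos (P.reflectionPerm (gradRoot b β i) j) then P.reflectionPerm (gradRoot b β i) j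
  else P.reflectionPerm (P.reflectionPerm (gradRoot b β i) j)
    (P.reflectionPerm (gradRoot b β i) j)

variable [Fintype ι]

lemma mem_posRoots {b : P.Base} {i : ι} : i ∈ posRoots b ↔ b.IsPos i := by
  simp [posRoots]

lemma isPos_foldRoot (i : Option b.support) (j : ι) : b.IsPos (foldRoot b β i j) := by
  unfold foldRoot
  split_ifs with h
  · exact h
  · exact (isPos_reflectionPerm_self b _).2 h

lemma foldRoot_foldRoot (i : Option b.support) {j : ι} (hj : b.IsPos j) :
    foldRoot b β i (foldRoot b β i j) = j := by
  have h2 : ∀ k : ι, P.reflectionPerm (P.reflectionPerm k k) (P.reflectionPerm k k) = k := by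
    intro k
    apply P.root.injective
    rw [root_reflectionPerm_self, root_reflectionPerm_self, neg_neg]
  by_cases h : b.IsPos (P.reflectionPerm (gradRoot b β i) j)
  · rw [show foldRoot b β i j = P.reflectionPerm (gradRoot b β i) j from if_pos h, foldRoot,
      RootPairing.reflectionPerm_self, if_pos hj]
  · rw [show foldRoot b β i j = _ from if_neg h, foldRoot, reflectionPerm_reflectionPerm_self,
      RootPairing.reflectionPerm_self, if_neg, h2]
    rw [isPos_reflectionPerm_self, not_not]
    exact hj

variable {b β} [P.IsRootSystem]

lemma isPos_gradRoot (hβ : IsHighestShort b β) (i : Option b.support) :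
    b.IsPos (gradRoot b β i) := by
  cases i with
  | none => exact hβ.isPos
  | some i => exact RootPairing.Base.isPos_of_mem_support i.2

lemma foldRoot_gradRoot (hβ : IsHighestShort b β) (i : Option b.support) :
    foldRoot b β i (gradRoot b β i) = gradRoot b β i := by
  rw [foldRoot, if_neg]
  · apply P.root.injective
    rw [root_reflectionPerm_self, root_reflectionPerm_self, neg_neg]
  · rw [isPos_reflectionPerm_self, not_not]
    exact isPos_gradRoot hβ i

lemma foldRoot_ne (hβ : IsHighestShort b β) (i : Option b.support) {j : ι} (hj : b.IsPos j)
    (hne : j ≠ gradRoot b β i) : foldRoot b β i j ≠ gradRoot b β i := by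
  intro h
  have := foldRoot_foldRoot b β i hj
  rw [h, foldRoot_gradRoot hβ] at this
  exact hne this.symm

/-- The positive roots other than `θ`. -/
def otherRoots (b : P.Base) (β : ι) (i : Option b.support) : Finset ι :=
  letI := Classical.decEq ι
  (posRoots b).erase (gradRoot b β i)

lemma mem_otherRoots {i : Option b.support} {j : ι} :
    j ∈ otherRoots b β i ↔ b.IsPos j ∧ j ≠ gradRoot b β i := by
  simp [otherRoots, mem_posRoots, and_comm]

lemma sum_posRoots (hβ : IsHighestShort b β) (i : Option b.support) {M : Type*} [AddCommMonoid M]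
    (F : ι → M) :
    ∑ j ∈ posRoots b, F j = F (gradRoot b β i) + ∑ j ∈ otherRoots b β i, F j := by
  let := Classical.decEq ι
  exact (Finset.add_sum_erase _ _ (mem_posRoots.2 (isPos_gradRoot hβ i))).symm

lemma sum_otherRoots_congr (hβ : IsHighestShort b β) (i : Option b.support) {M : Type*}
    [AddCommMonoid M] {F G : ι → M}
    (h : ∀ j ∈ otherRoots b β i, F j = G (foldRoot b β i j)) :
    ∑ j ∈ otherRoots b β i, F j = ∑ j ∈ otherRoots b β i, G j := by
  have hm : ∀ j ∈ otherRoots b β i, foldRoot b β i j ∈ otherRoots b β i := by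
    intro j hj
    rw [mem_otherRoots] at hj ⊢
    exact ⟨isPos_foldRoot b β i j, foldRoot_ne hβ i hj.1 hj.2⟩
  refine Finset.sum_nbij' (foldRoot b β i) (foldRoot b β i) hm hm ?_ ?_ h <;>
  · intro j hj
    exact foldRoot_foldRoot b β i (mem_otherRoots.1 hj).1

variable [P.IsReduced]

/-- A finite simple reflection permutes the other positive roots and has no translation part. For
`s₀`, the value `(α^∨, β) = 0` means that `α` is fixed by `s_β`, and the value `1` means that `α`
becomes negative. So a sign change occurs exactly when the translation contributes `1`. -/
lemma isPos_or_not_isPos_reflectionPerm (hβ : IsHighestShort b β) {i : Option b.support} {j : ι}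
    (hj : j ∈ otherRoots b β i) :
    (b.IsPos (P.reflectionPerm (gradRoot b β i) j) ∧
      shift b i * intPairing P j (rootWeight P (gradRoot b β i)) = 0) ∨
    (¬ b.IsPos (P.reflectionPerm (gradRoot b β i) j) ∧
      shift b i * intPairing P j (rootWeight P (gradRoot b β i)) = 1) := by
  rw [mem_otherRoots] at hj
  cases i with
  | some i => exact Or.inl ⟨hj.1.reflectionPerm i.2 hj.2, by simp [shift]⟩
  | none =>
    simp only [shift, gradRoot, one_mul] at hj ⊢
    have h0 := hβ.inner_nonneg hj.1
    rcases hβ.inner_coroot_eq_zero_or_one h0 hj.2 with h | h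
    · left
      have h' : intPairing P j (rootWeight P β) = 0 := by
        rw [intPairing_eq_iff]; exact_mod_cast h
      refine ⟨?_, h'⟩
      have : P.reflectionPerm β j = j := by
        apply P.coroot.injective
        rw [coroot_reflectionPerm_eq, h, zero_smul, sub_zero]
      rw [this]; exact hj.1
    · right
      refine ⟨hβ.not_isPos_reflectionPerm (lt_of_le_of_ne h0 fun h1 => ?_), ?_⟩
      · rw [inner_coroot_eq, ← h1] at h
        simp at h
      · rw [intPairing_eq_iff]; exact_mod_cast h

/-- The dichotomy behind all later computations: passing to the folded root either preserves the
coordinate or replaces it by `1 - n`. -/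
lemma foldRoot_cases (hβ : IsHighestShort b β) {i : Option b.support} {j : ι}
    (hj : j ∈ otherRoots b β i) :
    (foldRoot b β i j = P.reflectionPerm (gradRoot b β i) j ∧
      ∀ μ, intPairing P j (reflWeight b β i μ) = intPairing P (foldRoot b β i j) μ) ∨
    (P.reflectionPerm (foldRoot b β i j) (foldRoot b β i j) =
        P.reflectionPerm (gradRoot b β i) j ∧
      ∀ μ, intPairing P j (reflWeight b β i μ) = 1 - intPairing P (foldRoot b β i j) μ) := by
  rcases isPos_or_not_isPos_reflectionPerm hβ hj with ⟨h, h'⟩ | ⟨h, h'⟩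
  · left
    have hf : foldRoot b β i j = P.reflectionPerm (gradRoot b β i) j := if_pos h
    exact ⟨hf, fun μ => by rw [intPairing_reflWeight, h', hf, add_zero]⟩
  · right
    have hf : foldRoot b β i j = P.reflectionPerm (P.reflectionPerm (gradRoot b β i) j)
      (P.reflectionPerm (gradRoot b β i) j) := if_neg h
    refine ⟨?_, fun μ => ?_⟩
    · rw [hf]
      apply P.root.injective
      rw [root_reflectionPerm_self, root_reflectionPerm_self, neg_neg]
    · rw [intPairing_reflWeight, h', hf, intPairing_reflectionPerm_self]
      ring

/-! ### The number of affine hyperplanes separating a weight from the fundamental alcove -/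

/-- The number of hyperplanes `(α^∨, x) = r` which separate a point with `(α^∨, x) = n` from the
fundamental alcove. -/
def excess (n : ℤ) : ℤ := if 0 < n then n - 1 else -n

lemma excess_nonneg (n : ℤ) : 0 ≤ excess n := by
  unfold excess; split_ifs <;> omega

lemma excess_one_sub (n : ℤ) : excess (1 - n) = excess n := by
  unfold excess; split_ifs <;> omega

lemma excess_eq_zero {n : ℤ} : excess n = 0 ↔ n = 0 ∨ n = 1 := by
  unfold excess; split_ifs <;> omega

/-- The number of affine hyperplanes which separate `μ` from the fundamental alcove. -/
def level (b : P.Base) (μ : weightLattice P) : ℤ :=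
  ∑ j ∈ posRoots b, excess (intPairing P j μ)

omit [P.IsRootSystem] [P.IsReduced] in
lemma level_nonneg (b : P.Base) (μ : weightLattice P) : 0 ≤ level b μ :=
  Finset.sum_nonneg fun _ _ => excess_nonneg _

omit [P.IsRootSystem] [P.IsReduced] in
lemma level_eq_zero_iff (b : P.Base) (μ : weightLattice P) :
    level b μ = 0 ↔ (μ : V) ∈ minuscule b := by
  rw [level, Finset.sum_eq_zero_iff_of_nonneg fun _ _ => excess_nonneg _]
  simp only [mem_posRoots, excess_eq_zero, intPairing_eq_iff]
  simp only [Int.cast_zero, Int.cast_one]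
  exact ⟨fun h => ⟨μ.2, h⟩, fun h => h.2⟩

/-- `excess` is invariant under `n ↦ 1 - n`, so the roots other than `θ` only permute their
contributions; the change comes from `θ` alone. -/
lemma level_reflWeight (hβ : IsHighestShort b β) (i : Option b.support) (μ : weightLattice P) :
    level b (reflWeight b β i μ) = level b μ + (wallValue b β i μ).sign := by
  have h1 : ∑ j ∈ otherRoots b β i, excess (intPairing P j (reflWeight b β i μ)) =
      ∑ j ∈ otherRoots b β i, excess (intPairing P j μ) := by
    refine sum_otherRoots_congr hβ i (G := fun j => excess (intPairing P j μ)) fun j hj => ?_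
    rcases foldRoot_cases hβ hj with ⟨-, h⟩ | ⟨-, h⟩
    · rw [h]
    · rw [h, excess_one_sub]
  have h2 : excess (intPairing P (gradRoot b β i) (reflWeight b β i μ)) =
      excess (intPairing P (gradRoot b β i) μ) + (wallValue b β i μ).sign := by
    rw [intPairing_gradRoot_reflWeight]
    cases i with
    | none =>
      simp only [shift, gradRoot, wallValue]
      generalize intPairing P β μ = n
      rcases lt_trichotomy n 1 with h | rfl | h
      · rw [Int.sign_eq_one_of_pos (by omega)]
        unfold excess; split_ifs <;> omega
      · rfl
      · rw [Int.sign_eq_neg_one_of_neg (by omega)]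
        unfold excess; split_ifs <;> omega
    | some k =>
      simp only [shift, gradRoot, wallValue]
      generalize intPairing P k μ = n
      rcases lt_trichotomy n 0 with h | rfl | h
      · rw [Int.sign_eq_neg_one_of_neg h]
        unfold excess; split_ifs <;> omega
      · rfl
      · rw [Int.sign_eq_one_of_pos h]
        unfold excess; split_ifs <;> omega
  rw [level, level, sum_posRoots hβ i, sum_posRoots hβ i, h1, h2]
  ring

lemma level_reflWeight_le (hβ : IsHighestShort b β) (i : Option b.support) (μ : weightLattice P) :
    level b (reflWeight b β i μ) ≤ level b μ + 1 := by
  rw [level_reflWeight hβ]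
  have : (wallValue b β i μ).sign ≤ 1 := by
    rcases Int.sign_trichotomy (wallValue b β i μ) with h | h | h <;> omega
  omega

/-- If no wall value is negative, then `μ` is dominant with `(β^∨, μ) ≤ 1`; since `β^∨` dominates
all coroots on dominant vectors, every `(α^∨, μ)` with `α > 0` is `0` or `1`. -/
lemma exists_wallValue_neg [P.IsIrreducible] (hβ : IsHighestShort b β) {μ : weightLattice P}
    (hμ : (μ : V) ∉ minuscule b) : ∃ i, wallValue b β i μ < 0 := by
  by_contra! h
  apply hμ
  have hdom : ∀ j ∈ b.support, 0 ≤ ⟪P.root j, (μ : V)⟫ := by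
    intro j hj
    rw [← inner_coroot_nonneg, ← intPairing_cast]
    exact_mod_cast h (some ⟨j, hj⟩)
  refine ⟨μ.2, fun i hi => ?_⟩
  have h1 := hβ.inner_coroot_le hdom i
  have h2 := inner_coroot_nonneg.2 (inner_root_nonneg_of_isPos hi hdom)
  have h3 := h none
  simp only [wallValue] at h3
  rw [← intPairing_cast, ← intPairing_cast] at h1
  rw [← intPairing_cast] at h2 ⊢
  have h1 : intPairing P i μ ≤ intPairing P β μ := by exact_mod_cast h1
  have h2 : 0 ≤ intPairing P i μ := by exact_mod_cast h2
  rcases (by omega : intPairing P i μ = 0 ∨ intPairing P i μ = 1) with h | h <;> simp [h]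

/-! ### Words -/

omit [Fintype ι] [P.IsRootSystem] [P.IsReduced] in
lemma partialWeight_cons (β : ι) (i : Option b.support) (l : List (Option b.support))
    (ν : weightLattice P) (n : ℕ) :
    partialWeight b β (i :: l) ν (n + 1) = partialWeight b β l (reflWeight b β i ν) n := rfl

omit [Fintype ι] [P.IsRootSystem] [P.IsReduced] in
lemma partialWeight_length (β : ι) (l : List (Option b.support)) (ν : weightLattice P) :
    (partialWeight b β l ν l.length : V) = (wordProd b β l)⁻¹ ν := by
  induction l generalizing ν with
  | nil => simp [partialWeight, wordProd]
  | cons i l ih =>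
    rw [List.length_cons, partialWeight_cons, ih]
    have : (simpleRefl b β i)⁻¹ = simpleRefl b β i :=
      inv_eq_of_mul_eq_one_left (simpleRefl_mul_self b β i)
    simp only [wordProd, List.map_cons, List.prod_cons, mul_inv_rev, this, Equiv.Perm.mul_apply]
    rfl

lemma level_partialWeight_le (hβ : IsHighestShort b β) (l : List (Option b.support))
    (ν : weightLattice P) :
    level b (partialWeight b β l ν l.length) ≤ level b ν + l.length := by
  induction l generalizing ν with
  | nil => simp [partialWeight]
  | cons i l ih =>
    rw [List.length_cons, partialWeight_cons]
    have := ih (reflWeight b β i ν)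
    have := level_reflWeight_le hβ i ν
    push_cast
    omega

omit [Fintype ι] [P.IsRootSystem] [P.IsReduced] in
lemma wordProd_mem (β : ι) (l : List (Option b.support)) :
    wordProd b β l ∈ affineWeylGroup b β := by
  refine list_prod_mem fun x hx => ?_
  obtain ⟨i, -, rfl⟩ := List.mem_map.1 hx
  exact Subgroup.subset_closure ⟨i, rfl⟩

/-- Greedy descent: reflect in a wall with negative value until the level is zero. -/
lemma exists_word_to_minuscule [P.IsIrreducible] (hβ : IsHighestShort b β) (μ : weightLattice P) :
    ∃ l : List (Option b.support), (l.length : ℤ) = level b μ ∧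
      wordProd b β l μ ∈ minuscule b := by
  obtain ⟨n, hn⟩ := Int.eq_ofNat_of_zero_le (level_nonneg b μ)
  induction n generalizing μ with
  | zero => exact ⟨[], by simp [hn], by simpa [wordProd] using (level_eq_zero_iff b μ).1 hn⟩
  | succ n ih =>
    have hμ : (μ : V) ∉ minuscule b := by
      rw [← level_eq_zero_iff]; push_cast at hn; omega
    obtain ⟨i, hi⟩ := exists_wallValue_neg hβ hμ
    have hlev := level_reflWeight hβ i μ
    rw [Int.sign_eq_neg_one_of_neg hi, hn] at hlev
    obtain ⟨l, hl, hmem⟩ := ih (reflWeight b β i μ) (by rw [hlev]; push_cast; ring)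
    refine ⟨l ++ [i], ?_, ?_⟩
    · rw [List.length_append, Nat.cast_add, hl, hlev, hn]
      simp
    · have : wordProd b β (l ++ [i]) = wordProd b β l * simpleRefl b β i := by simp [wordProd]
      rw [this]
      exact hmem

omit [Fintype ι] [P.IsRootSystem] [P.IsReduced] [P.IsCrystallographic] [IsEuclidean P] in
lemma length_wordProd_le (l : List (Option b.support)) :
    length b β (wordProd b β l) ≤ l.length :=
  Nat.sInf_le ⟨l, rfl, rfl⟩

lemma exists_isShortestToMinuscule [P.IsIrreducible] (hβ : IsHighestShort b β)
    (μ : weightLattice P) : ∃ w, IsShortestToMinuscule b β (μ : V) w := by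
  classical
  obtain ⟨l, -, hl⟩ := exists_word_to_minuscule hβ μ
  have hex : ∃ n w, w ∈ affineWeylGroup b β ∧ w (μ : V) ∈ minuscule b ∧ length b β w = n :=
    ⟨_, _, wordProd_mem β l, hl, rfl⟩
  obtain ⟨w, hw, hmem, hlen⟩ := Nat.find_spec hex
  refine ⟨w, hw, hmem, fun w' hw' hmem' => ?_⟩
  rw [hlen]
  exact Nat.find_min' hex ⟨w', hw', hmem', rfl⟩

/-- The level grows by at most one per letter, which bounds it by the length of the word; the greedy
word bounds the length of the shortest `w` by the level. -/
lemma level_eq_length_of_isReducedExpression [P.IsIrreducible] (hβ : IsHighestShort b β)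
    {μ ν : weightLattice P} {w : Equiv.Perm V} (hw : IsShortestToMinuscule b β (μ : V) w)
    {l : List (Option b.support)} (hl : IsReducedExpression b β l w) (hν : (ν : V) = w μ) :
    level b ν = 0 ∧ partialWeight b β l ν l.length = μ ∧ level b μ = l.length := by
  have h0 : level b ν = 0 := (level_eq_zero_iff b ν).2 (hν ▸ hw.2.1)
  have h1 : partialWeight b β l ν l.length = μ := by
    apply Subtype.ext
    rw [partialWeight_length, hl.1, hν]
    exact w.symm_apply_apply μ
  refine ⟨h0, h1, le_antisymm ?_ ?_⟩
  · have := level_partialWeight_le hβ l ν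
    rwa [h1, h0, zero_add] at this
  · obtain ⟨l', hl', hmem⟩ := exists_word_to_minuscule hβ μ
    rw [← hl', hl.2]
    exact_mod_cast (hw.2.2 _ (wordProd_mem β l') hmem).trans (length_wordProd_le l')

end Combinatorics

/-! ### Module identities for rearranging the Cherednik operators. -/

section Auxiliary

variable {F M : Type*} [Field F] [CharZero F] [AddCommGroup M] [Module F M]

lemma smul_sub_sub_half_smul (a : F) (x d : M) :
    a • (x - d - (1 / 2 : F) • x) = -a • (d - (1 / 2 : F) • x) := by
  module

omit [CharZero F] in
lemma mul_smul_sub_half_smul (a k : F) (x d : M) :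
    (a * k) • d - (1 / 2 : F) • (a * k) • x = k • a • (d - (1 / 2 : F) • x) := by
  module

lemma add_smul_reorganize (k a e c : F) (x d s f q : M) :
    x + (e * a) • s + (k • a • (s - d + c • f - (1 / 2 : F) • s) + q) =
      x + (k • (-a) • (d - (1 / 2 : F) • s) + q) + (e * a) • s + (c * a * k) • f := by
  module

end Auxiliary

/-! ### Commutation of Cherednik operators with simple reflections. -/

section Operators

variable {P : RootPairing ι ℝ V V}

lemma expo_induction {p : ExpAlgebra P → Prop} (f : ExpAlgebra P) (h0 : p 0)
    (hadd : ∀ f g, p f → p g → p (f + g))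
    (hexpo : ∀ (c : CoeffField P) (μ : weightLattice P), p (c • expo μ)) : p f := by
  refine f.induction_linear h0 hadd fun μ c => ?_
  have := hexpo c μ
  rwa [expo, AddMonoidAlgebra.smul_single, smul_eq_mul, mul_one] at this

lemma end_ext {A B : Module.End (CoeffField P) (ExpAlgebra P)}
    (h : ∀ μ, A (expo μ) = B (expo μ)) : A = B := by
  refine LinearMap.ext fun f => ?_
  induction f using expo_induction with
  | h0 => simp
  | hadd f g hf hg => rw [map_add, map_add, hf, hg]
  | hexpo c μ => rw [map_smul, map_smul, h]

lemma linExt_apply (φ : weightLattice P → ExpAlgebra P) (f : ExpAlgebra P) :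
    linExt φ f = f.coeff.sum fun μ c => c • φ μ := rfl

lemma param_reflectionPerm (i j : ι) : param P (P.reflectionPerm i j) = param P j := by
  have : (Quotient.mk (MulAction.orbitRel P.weylGroupToPerm.range ι) (P.reflectionPerm i j)) =
      Quotient.mk (MulAction.orbitRel P.weylGroupToPerm.range ι) j := by
    apply Quotient.sound
    refine ⟨⟨P.reflectionPerm i, ?_⟩, rfl⟩
    rw [RootPairing.range_weylGroupToPerm]
    exact Subgroup.subset_closure ⟨i, rfl⟩
  rw [param, param, this]

/-- For `n ≥ 0` the sum `e^μ + e^{μ - γ} + ⋯ + e^{μ - (n - 1) γ}`, extended to all integers `n`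
by the rule that the sums for `n + 1` and `n` differ by `e^{μ - n γ}`. -/
def stringSum (γ : weightLattice P) (n : ℤ) (μ : weightLattice P) : ExpAlgebra P :=
  ∑ j ∈ Finset.range n.toNat, expo (μ - j • γ) -
    ∑ j ∈ Finset.range (-n).toNat, expo (μ + (j + 1) • γ)

lemma stringSum_zero (γ μ : weightLattice P) : stringSum γ 0 μ = 0 := by simp [stringSum]

lemma stringSum_add_one (γ : weightLattice P) (n : ℤ) (μ : weightLattice P) :
    stringSum γ (n + 1) μ = stringSum γ n μ + expo (μ - n • γ) := by
  rcases lt_or_ge n 0 with h | h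
  · obtain ⟨m, rfl⟩ : ∃ m : ℕ, n = -(m + 1 : ℕ) := ⟨(-n - 1).toNat, by omega⟩
    have h1 : (-(m + 1 : ℕ) + 1 : ℤ) = -m := by push_cast; ring
    rw [h1]
    simp only [stringSum, neg_neg, Int.toNat_natCast, Int.toNat_neg_natCast, Finset.range_zero,
      Finset.sum_empty, zero_sub, Finset.sum_range_succ, neg_smul, sub_neg_eq_add, natCast_zsmul]
    abel
  · obtain ⟨m, rfl⟩ := Int.eq_ofNat_of_zero_le h
    have h1 : (m + 1 : ℤ) = (m + 1 : ℕ) := by push_cast; ring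
    rw [h1]
    simp only [stringSum, Int.toNat_natCast, Int.toNat_neg_natCast, Finset.range_zero,
      Finset.sum_empty, sub_zero, Finset.sum_range_succ, natCast_zsmul]

/-- The left side does not depend on `n`, because the two sums gain and lose the same exponential.
This is how divided differences respond to the flip `n ↦ 1 - n` combined with a change of sign of
the root. -/
lemma stringSum_add_stringSum_neg (γ : weightLattice P) (n : ℤ) (μ : weightLattice P) :
    stringSum γ n μ + stringSum (-γ) (1 - n) μ = expo μ := by
  have key : ∀ n : ℤ, stringSum γ (n + 1) μ + stringSum (-γ) (1 - (n + 1)) μ =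
      stringSum γ n μ + stringSum (-γ) (1 - n) μ := by
    intro n
    rw [stringSum_add_one, show (1 : ℤ) - n = -n + 1 by ring, stringSum_add_one,
      show (1 : ℤ) - (n + 1) = -n by ring]
    rw [show -n • -γ = n • γ by simp]
    abel
  induction n with
  | zero =>
    rw [stringSum_zero, sub_zero, zero_add, show (1 : ℤ) = 0 + 1 by ring, stringSum_add_one,
      stringSum_zero]
    simp
  | succ n ih => rw [key, ih]
  | pred n ih =>
    rw [← ih, ← key (-n - 1), sub_add_cancel]

variable [IsEuclidean P] [P.IsCrystallographic]

lemma divDiff_expo (j : ι) (μ : weightLattice P) :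
    divDiff P j (expo μ) = stringSum (rootWeight P j) (intPairing P j μ) μ := by
  rw [divDiff, linExt_expo, stringSum]

variable {b : P.Base} {β : ι}

lemma reflOp_expo (i : Option b.support) (μ : weightLattice P) :
    reflOp b β i (expo μ) = expo (reflWeight b β i μ) := linExt_expo _ _

lemma coeff_reflOp (i : Option b.support) (f : ExpAlgebra P) (μ : weightLattice P) :
    (reflOp b β i f).coeff μ = f.coeff (reflWeight b β i μ) := by
  classical
  induction f using expo_induction with
  | h0 => simp
  | hadd f g hf hg =>
    rw [map_add, AddMonoidAlgebra.coeff_add, AddMonoidAlgebra.coeff_add, Finsupp.add_apply,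
      Finsupp.add_apply, hf, hg]
  | hexpo c ν =>
    rw [map_smul, reflOp_expo, AddMonoidAlgebra.coeff_smul_apply,
      AddMonoidAlgebra.coeff_smul_apply, expo, expo, AddMonoidAlgebra.coeff_single, AddMonoidAlgebra.coeff_single,
      Finsupp.single_apply, Finsupp.single_apply]
    have : reflWeight b β i ν = μ ↔ ν = reflWeight b β i μ := by
      constructor
      · rintro rfl; rw [reflWeight_reflWeight]
      · rintro rfl; rw [reflWeight_reflWeight]
    simp only [this]

lemma reflWeight_sub_zsmul (i : Option b.support) (μ : weightLattice P) (n : ℤ) (j : ι) :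
    reflWeight b β i (μ - n • rootWeight P j) =
      reflWeight b β i μ - n • rootWeight P (P.reflectionPerm (gradRoot b β i) j) := by
  rw [reflWeight_eq, reflWeight_eq, intPairing_sub, intPairing_zsmul, rootWeight_reflectionPerm]
  module

lemma reflOp_stringSum (i : Option b.support) (j : ι) (n : ℤ) (μ : weightLattice P) :
    reflOp b β i (stringSum (rootWeight P j) n μ) =
      stringSum (rootWeight P (P.reflectionPerm (gradRoot b β i) j)) n (reflWeight b β i μ) := by
  have h1 : ∀ m : ℕ, reflWeight b β i (μ - m • rootWeight P j) =
      reflWeight b β i μ - m • rootWeight P (P.reflectionPerm (gradRoot b β i) j) := by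
    intro m
    simpa using reflWeight_sub_zsmul (β := β) i μ m j
  have h2 : ∀ m : ℕ, reflWeight b β i (μ + m • rootWeight P j) =
      reflWeight b β i μ + m • rootWeight P (P.reflectionPerm (gradRoot b β i) j) := by
    intro m
    simpa using reflWeight_sub_zsmul (β := β) i μ (-m) j
  simp only [stringSum, map_sub, map_sum, reflOp_expo, h1, h2]

/-- The strings for `θ` through `μ` and `sᵢ μ` are mirror images up to one endpoint. The extra term
is `-f` for a finite reflection and `+f` for `s₀`, hence the sign `2e - 1`. -/
lemma divDiff_gradRoot_reflOp (i : Option b.support) (f : ExpAlgebra P) :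
    divDiff P (gradRoot b β i) (reflOp b β i f) =
      reflOp b β i f - reflOp b β i (divDiff P (gradRoot b β i) f) +
        ((2 * shift b i - 1 : ℤ) : CoeffField P) • f := by
  suffices h : divDiff P (gradRoot b β i) * reflOp b β i =
      reflOp b β i - reflOp b β i * divDiff P (gradRoot b β i) +
        ((2 * shift b i - 1 : ℤ) : CoeffField P) • 1 from LinearMap.congr_fun h f
  refine end_ext fun μ => ?_
  simp only [Module.End.mul_apply, LinearMap.add_apply, LinearMap.sub_apply, LinearMap.smul_apply,
    Module.End.one_apply, reflOp_expo, divDiff_expo, reflOp_stringSum,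
    intPairing_gradRoot_reflWeight, rootWeight_reflectionPerm_self]
  set θ := gradRoot b β i with hθ
  set n := intPairing P θ μ with hn
  set ν := reflWeight b β i μ with hν
  have h1 := stringSum_add_stringSum_neg (P := P) (rootWeight P θ) (1 - n) ν
  rw [sub_sub_cancel] at h1
  have hμν : ν = μ - (n - shift b i) • rootWeight P θ := reflWeight_eq b β i μ
  cases i with
  | none =>
    simp only [shift] at hμν ⊢
    rw [show (2 * 1 - n : ℤ) = (1 - n) + 1 by ring, stringSum_add_one, ← h1,
      show ν - (1 - n) • rootWeight P θ = μ by rw [hμν]; module]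
    norm_num
  | some k =>
    simp only [shift] at hμν ⊢
    have h2 := stringSum_add_one (P := P) (rootWeight P θ) (-n) ν
    rw [show -n + 1 = 1 - n by ring,
      show ν - (-n) • rootWeight P θ = μ by rw [hμν]; module] at h2
    rw [← h1, h2, show (2 * 0 - n : ℤ) = -n by ring]
    norm_num

variable [Fintype ι] [P.IsRootSystem] [P.IsReduced]

omit [P.IsCrystallographic] [Fintype ι] [P.IsRootSystem] [P.IsReduced] in
lemma inner_reflection_left (i : ι) (x y : V) :
    ⟪P.reflection i x, y⟫ = ⟪x, P.reflection i y⟫ := by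
  rw [RootPairing.reflection_apply, RootPairing.reflection_apply, ← inner_coroot, ← inner_coroot,
    inner_coroot_eq, inner_coroot_eq, inner_sub_left, inner_sub_right, inner_smul_left,
    inner_smul_right, conj_trivial, real_inner_comm (P.root i) x]
  ring

lemma param_foldRoot (i : Option b.support) (j : ι) :
    param P (foldRoot b β i j) = param P j := by
  unfold foldRoot
  split_ifs <;> simp only [param_reflectionPerm]

/-- Up to sign, `sᵢ` permutes the summands of the Cherednik operator for the roots `α ≠ θ`. -/
lemma smul_divDiff_reflOp (hβ : IsHighestShort b β) {i : Option b.support} {j : ι}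
    (hj : j ∈ otherRoots b β i) (y : V) (f : ExpAlgebra P) :
    algebraMap ℝ (CoeffField P) ⟪y, P.root j⟫ •
        (divDiff P j (reflOp b β i f) - (1 / 2 : CoeffField P) • reflOp b β i f) =
      algebraMap ℝ (CoeffField P)
          ⟪P.reflection (gradRoot b β i) y, P.root (foldRoot b β i j)⟫ •
        (reflOp b β i (divDiff P (foldRoot b β i j) f) -
          (1 / 2 : CoeffField P) • reflOp b β i f) := by
  set θ := gradRoot b β i with hθ
  have hroot : P.reflection θ (P.root (P.reflectionPerm θ j)) = P.root j := by
    rw [P.root_reflectionPerm, RootPairing.reflection_same]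
  rcases foldRoot_cases hβ hj with ⟨hf, hn⟩ | ⟨hf, hn⟩
  · have key : divDiff P j * reflOp b β i = reflOp b β i * divDiff P (foldRoot b β i j) := by
      refine end_ext fun μ => ?_
      simp only [Module.End.mul_apply, reflOp_expo, divDiff_expo, reflOp_stringSum, hn, hf]
      rw [RootPairing.reflectionPerm_self]
    have key := LinearMap.congr_fun key f
    simp only [Module.End.mul_apply] at key
    rw [key, inner_reflection_left, hf, hroot]
  · have hf' : P.root (foldRoot b β i j) = -P.root (P.reflectionPerm θ j) := by
      rw [← hf, root_reflectionPerm_self, neg_neg]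
    -- In the flipped case `Δ_j sᵢ = sᵢ - sᵢ Δ_{j'}`, with `j'` the folded root. So `Δ - 1/2`
    -- changes sign, and `(y, α)` changes sign with it.
    have key : divDiff P j * reflOp b β i + reflOp b β i * divDiff P (foldRoot b β i j) =
        reflOp b β i := by
      refine end_ext fun μ => ?_
      simp only [Module.End.mul_apply, LinearMap.add_apply, reflOp_expo, divDiff_expo,
        reflOp_stringSum, hn]
      have hw : rootWeight P (P.reflectionPerm θ (foldRoot b β i j)) = -rootWeight P j := by
        apply Subtype.ext
        change P.root _ = - P.root j
        rw [P.root_reflectionPerm, hf', map_neg, hroot]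
      rw [hw, ← stringSum_add_stringSum_neg (rootWeight P j)
        (1 - intPairing P (foldRoot b β i j) μ) (reflWeight b β i μ), sub_sub_cancel]
    have key := LinearMap.congr_fun key f
    simp only [Module.End.mul_apply, LinearMap.add_apply] at key
    rw [inner_reflection_left, hf', map_neg, hroot, inner_neg_right, map_neg,
      eq_sub_of_add_eq key, smul_sub_sub_half_smul]

omit [P.IsCrystallographic] [P.IsRootSystem] [P.IsReduced] [IsEuclidean P] in
lemma pairingExt_rho (y : V) : pairingExt P y (rho b) =
    (1 / 2) * ∑ j ∈ posRoots b, algebraMap ℝ (CoeffField P) ⟪y, P.root j⟫ * param P j := by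
  rw [rho, map_smul, map_sum, smul_eq_mul]
  congr 1
  refine Finset.sum_congr rfl fun j _ => ?_
  rw [pairingExt_tmul, mul_comm]

omit [P.IsRootSystem] [P.IsReduced] in
-- Distributing `(y, ρ)` over the roots gives summands with `Δ_α - 1/2`, the form in which a sign
-- change of the root is harmless.
lemma cherednik_apply (y : V) (f : ExpAlgebra P) : cherednik b y f = dirDeriv P y f +
    ∑ j ∈ posRoots b, param P j • algebraMap ℝ (CoeffField P) ⟪y, P.root j⟫ •
      (divDiff P j f - (1 / 2 : CoeffField P) • f) := by
  simp only [cherednik, pairingExt_rho, LinearMap.sub_apply, LinearMap.add_apply,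
    LinearMap.sum_apply, LinearMap.smul_apply, Module.End.one_apply]
  rw [add_sub_assoc]
  congr 1
  rw [mul_smul, Finset.sum_smul, Finset.smul_sum, ← Finset.sum_sub_distrib]
  exact Finset.sum_congr rfl fun j _ => mul_smul_sub_half_smul _ _ _ _

omit [Fintype ι] [P.IsRootSystem] [P.IsReduced] in
lemma inner_reflWeight (i : Option b.support) (y : V) (μ : weightLattice P) :
    ⟪y, (reflWeight b β i μ : V)⟫ = ⟪P.reflection (gradRoot b β i) y, (μ : V)⟫ +
      shift b i * ⟪y, P.root (gradRoot b β i)⟫ := by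
  change ⟪y, simpleRefl b β i μ⟫ = _
  rw [simpleRefl_apply, inner_reflection_left, RootPairing.reflection_apply, ← inner_coroot,
    inner_sub_right, inner_sub_right, inner_smul_right, inner_smul_right]
  ring

omit [Fintype ι] [P.IsRootSystem] [P.IsReduced] in
lemma dirDeriv_reflOp (i : Option b.support) (y : V) (f : ExpAlgebra P) :
    dirDeriv P y (reflOp b β i f) =
      reflOp b β i (dirDeriv P (P.reflection (gradRoot b β i) y) f) +
      (shift b i * algebraMap ℝ (CoeffField P) ⟪y, P.root (gradRoot b β i)⟫) •
        reflOp b β i f := by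
  suffices h : dirDeriv P y * reflOp b β i =
      reflOp b β i * dirDeriv P (P.reflection (gradRoot b β i) y) +
      (shift b i * algebraMap ℝ (CoeffField P) ⟪y, P.root (gradRoot b β i)⟫) • reflOp b β i from
    LinearMap.congr_fun h f
  refine end_ext fun μ => ?_
  simp only [Module.End.mul_apply, LinearMap.add_apply, LinearMap.smul_apply, reflOp_expo,
    dirDeriv, linExt_expo, map_smul, inner_reflWeight, map_add, map_mul, map_intCast, add_smul]

/-- The commutation relation between the Cherednik operators and the simple reflections. -/
lemma cherednik_reflOp (hβ : IsHighestShort b β) (i : Option b.support) (y : V)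
    (f : ExpAlgebra P) :
    cherednik b y (reflOp b β i f) =
      reflOp b β i (cherednik b (P.reflection (gradRoot b β i) y) f) +
      (shift b i * algebraMap ℝ (CoeffField P) ⟪y, P.root (gradRoot b β i)⟫) • reflOp b β i f +
      (((2 * shift b i - 1 : ℤ) : CoeffField P) *
        algebraMap ℝ (CoeffField P) ⟪y, P.root (gradRoot b β i)⟫ *
        param P (gradRoot b β i)) • f := by
  rw [cherednik_apply, cherednik_apply, map_add, dirDeriv_reflOp, map_sum, sum_posRoots hβ i,
    sum_posRoots hβ i]
  simp only [map_smul, map_sub]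
  -- Reindexing by the folding involution matches the summands for `α ≠ θ` exactly; only `∂_y` and
  -- the summand for `θ` produce correction terms.
  rw [sum_otherRoots_congr hβ i (G := fun j => param P j • algebraMap ℝ (CoeffField P)
    ⟪P.reflection (gradRoot b β i) y, P.root j⟫ • (reflOp b β i (divDiff P j f) -
      (1 / 2 : CoeffField P) • reflOp b β i f))
    fun j hj => by rw [smul_divDiff_reflOp hβ hj, param_foldRoot]]
  rw [inner_reflection_left _ y (P.root _), RootPairing.reflection_apply_self, inner_neg_right,
    map_neg, divDiff_gradRoot_reflOp]
  exact add_smul_reorganize _ _ _ _ _ _ _ _ _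

end Operators

/-! ### Eigenvalues, intertwiners, uniqueness and the product formula. -/

section Spectrum

variable {P : RootPairing ι ℝ V V} [IsEuclidean P] [P.IsCrystallographic] [Fintype ι]
  {b : P.Base} {β : ι}

lemma pairingExt_tilde (y : V) (μ : weightLattice P) : pairingExt P y (tilde b μ) =
    algebraMap ℝ (CoeffField P) ⟪y, (μ : V)⟫ + ∑ j ∈ posRoots b, param P j *
      (1 / 2 * ((eps (intPairing P j μ) : CoeffField P) *
        algebraMap ℝ (CoeffField P) ⟪y, P.root j⟫)) := by
  rw [tilde, map_add, map_smul, map_sum, pairingExt_tmul, one_mul, smul_eq_mul, Finset.mul_sum]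
  congr 1
  refine Finset.sum_congr rfl fun j _ => ?_
  rw [pairingExt_tmul]
  ring

lemma pairingExt_sub_left (y z : V) (x : CoeffField P ⊗[ℝ] V) :
    pairingExt P (y - z) x = pairingExt P y x - pairingExt P z x := by
  induction x using TensorProduct.induction_on with
  | zero => simp
  | tmul c v => simp [inner_sub_left, mul_sub]
  | add x x' h h' => rw [map_add, map_add, map_add, h, h']; ring

lemma pairingExt_smul_left (r : ℝ) (y : V) (x : CoeffField P ⊗[ℝ] V) :
    pairingExt P (r • y) x = algebraMap ℝ (CoeffField P) r * pairingExt P y x := by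
  induction x using TensorProduct.induction_on with
  | zero => simp
  | tmul c v => simp only [pairingExt_tmul, inner_smul_left, conj_trivial, map_mul]; ring
  | add x x' h h' => rw [map_add, map_add, h, h']; ring

/-- The value `(aᵢ, μ̃)`. -/
def wallValueExt (b : P.Base) (β : ι) (i : Option b.support) (μ : weightLattice P) :
    CoeffField P :=
  affPairingExt P (simpleAff b β i) (tilde b μ)

/-- The convention `ε₀ = -1` is what makes this hold at `n = 0` and `n = 1`. -/
lemma eps_reflect {n : ℤ} : eps (1 - n) = -eps n := by
  unfold eps; split_ifs <;> omega

/-- `(y, sᵢ x) = (y, x) ∓ (y, θ) (aᵢ, x)` for `x = μ̃`. -/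
lemma pairingExt_reflection (i : Option b.support) (y : V) (μ : weightLattice P) :
    pairingExt P (P.reflection (gradRoot b β i) y) (tilde b μ) +
        shift b i * algebraMap ℝ (CoeffField P) ⟪y, P.root (gradRoot b β i)⟫ =
      pairingExt P y (tilde b μ) + ((2 * shift b i - 1 : ℤ) : CoeffField P) *
        algebraMap ℝ (CoeffField P) ⟪y, P.root (gradRoot b β i)⟫ * wallValueExt b β i μ := by
  have h : P.reflection (gradRoot b β i) y = y -
      ⟪y, P.root (gradRoot b β i)⟫ • P.coroot (gradRoot b β i) := by
    rw [RootPairing.reflection_apply, ← inner_coroot, inner_coroot_eq, IsEuclidean.coroot_eq,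
      smul_smul, real_inner_comm y, mul_comm]
  rw [h, pairingExt_sub_left, pairingExt_smul_left, wallValueExt, affPairingExt]
  cases i with
  | none =>
    have h2 : pairingExt P (-P.coroot β) (tilde b μ) = - pairingExt P (P.coroot β) (tilde b μ) := by
      rw [← neg_one_smul ℝ, pairingExt_smul_left]; simp
    simp only [simpleAff, shift, gradRoot, h2, map_one]
    push_cast
    ring
  | some k =>
    simp only [simpleAff, shift, gradRoot, map_zero]
    push_cast
    ring

variable [P.IsRootSystem] [P.IsReduced]

/-- The tilde commutes with `sᵢ` off its wall: the folding matches the roots other than `θ`, and `ε`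
for `θ` changes sign precisely because `μ` is not fixed. -/
lemma pairingExt_tilde_reflWeight (hβ : IsHighestShort b β) {i : Option b.support}
    {μ : weightLattice P} (hμ : wallValue b β i μ ≠ 0) (y : V) :
    pairingExt P y (tilde b (reflWeight b β i μ)) =
      pairingExt P (P.reflection (gradRoot b β i) y) (tilde b μ) +
        shift b i * algebraMap ℝ (CoeffField P) ⟪y, P.root (gradRoot b β i)⟫ := by
  rw [pairingExt_tilde, pairingExt_tilde, sum_posRoots hβ i, sum_posRoots hβ i,
    inner_reflWeight]
  have h1 : eps (intPairing P (gradRoot b β i) (reflWeight b β i μ)) =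
      -eps (intPairing P (gradRoot b β i) μ) := by
    rw [intPairing_gradRoot_reflWeight]
    cases i with
    | none =>
      simp only [wallValue, shift, gradRoot] at hμ ⊢
      unfold eps; split_ifs <;> omega
    | some k =>
      simp only [wallValue, shift, gradRoot] at hμ ⊢
      unfold eps; split_ifs <;> omega
  rw [sum_otherRoots_congr hβ i (G := fun j => param P j *
      (1 / 2 * ((eps (intPairing P j μ) : CoeffField P) *
        algebraMap ℝ (CoeffField P) ⟪P.reflection (gradRoot b β i) y, P.root j⟫))) ?_]
  · rw [h1, inner_reflection_left _ y (P.root _), RootPairing.reflection_apply_self,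
      inner_neg_right, map_neg, map_add, map_mul, map_intCast]
    push_cast
    ring
  · intro j hj
    have hroot : P.reflection (gradRoot b β i)
        (P.root (P.reflectionPerm (gradRoot b β i) j)) = P.root j := by
      rw [P.root_reflectionPerm, RootPairing.reflection_same]
    simp only [param_foldRoot]
    rcases foldRoot_cases hβ hj with ⟨hf, hn⟩ | ⟨hf, hn⟩
    · rw [hn, inner_reflection_left, hf, hroot]
    · have hf' : P.root (foldRoot b β i j) = -P.root (P.reflectionPerm (gradRoot b β i) j) := by
        rw [← hf, root_reflectionPerm_self, neg_neg]
      rw [hn, eps_reflect, inner_reflection_left, hf', map_neg, hroot, inner_neg_right, map_neg]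
      push_cast
      ring

lemma simpleParam_eq (b : P.Base) (β : ι) (i : Option b.support) :
    simpleParam b β i = param P (gradRoot b β i) := by
  cases i <;> rfl

/-- `sᵢ + kᵢ (aᵢ, μ̃)⁻¹` maps joint eigenvectors for `μ` to joint eigenvectors for `sᵢ μ`. -/
lemma cherednik_intertwiner (hβ : IsHighestShort b β) {i : Option b.support}
    {μ : weightLattice P} (hμ : wallValue b β i μ ≠ 0) (hμ' : wallValueExt b β i μ ≠ 0)
    {f : ExpAlgebra P} (hf : ∀ y, cherednik b y f = pairingExt P y (tilde b μ) • f) (y : V) :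
    cherednik b y (reflOp b β i f + (simpleParam b β i * (wallValueExt b β i μ)⁻¹) • f) =
      pairingExt P y (tilde b (reflWeight b β i μ)) •
        (reflOp b β i f + (simpleParam b β i * (wallValueExt b β i μ)⁻¹) • f) := by
  rw [map_add, map_smul, cherednik_reflOp hβ, hf, hf, map_smul, pairingExt_tilde_reflWeight hβ hμ,
    smul_add]
  -- The new eigenvalue exceeds the old one by `(2e - 1)(y, θ)(aᵢ, μ̃)`. Multiplied by the constant
  -- `kᵢ (aᵢ, μ̃)⁻¹`, this is the coefficient of `f` left by the commutation relation.
  have h := pairingExt_reflection (β := β) i y μ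
  rw [add_smul _ _ (reflOp b β i f), add_assoc (_ + _), smul_smul, smul_smul, h, ← add_smul,
    simpleParam_eq]
  congr 1
  rw [← add_smul]
  congr 1
  field_simp
  ring

omit [P.IsRootSystem] [P.IsReduced] in
-- For `(α^∨, ν) = 0` or `1` the divided difference of `e^ν` is `0` or `e^ν`, so `Δ_α - 1/2` acts on
-- it as `ε / 2`.
lemma cherednik_expo_of_minuscule {ν : weightLattice P} (hν : level b ν = 0) (y : V) :
    cherednik b y (expo ν) = pairingExt P y (tilde b ν) • expo ν := by
  rw [cherednik_apply, pairingExt_tilde, add_smul, Finset.sum_smul, dirDeriv, linExt_expo]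
  congr 1
  refine Finset.sum_congr rfl fun j hj => ?_
  rw [divDiff_expo]
  rw [level, Finset.sum_eq_zero_iff_of_nonneg fun _ _ => excess_nonneg _] at hν
  rcases excess_eq_zero.1 (hν j hj) with h | h
  · rw [h, stringSum_zero, zero_sub, ← neg_smul, smul_smul, smul_smul]
    congr 1
    simp only [eps, lt_irrefl, if_false]
    push_cast
    ring
  · have h1 : stringSum (rootWeight P j) 1 ν = expo ν := by
      have := stringSum_add_one (rootWeight P j) 0 ν
      rwa [zero_add, stringSum_zero, zero_add, zero_smul, sub_zero] at this
    rw [h, h1, smul_sub, smul_sub, smul_smul, smul_smul, smul_smul, ← sub_smul]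
    congr 1
    simp only [eps, zero_lt_one, if_true]
    push_cast
    ring

/-! ### Specialization at `k = 0` -/

omit [IsEuclidean P] [P.IsCrystallographic] [Fintype ι] [P.IsRootSystem] [P.IsReduced] in
lemma algebraMap_C (r : ℝ) :
    algebraMap (MvPolynomial (Param P) ℝ) (CoeffField P) (MvPolynomial.C r) =
      algebraMap ℝ (CoeffField P) r :=
  (IsScalarTower.algebraMap_apply ℝ (MvPolynomial (Param P) ℝ) (CoeffField P) r).symm

omit [IsEuclidean P] [P.IsCrystallographic] [Fintype ι] [P.IsRootSystem] [P.IsReduced] in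
lemma algebraMap_half : algebraMap ℝ (CoeffField P) (1 / 2) = 1 / 2 := by
  rw [map_div₀, map_one, map_ofNat (algebraMap ℝ (CoeffField P)) 2]

omit [P.IsRootSystem] [P.IsReduced] in
lemma exists_algebraMap_eq_pairingExt_tilde (y : V) (μ : weightLattice P) :
    ∃ p : MvPolynomial (Param P) ℝ, MvPolynomial.constantCoeff p = ⟪y, (μ : V)⟫ ∧
      algebraMap (MvPolynomial (Param P) ℝ) (CoeffField P) p = pairingExt P y (tilde b μ) := by
  refine ⟨MvPolynomial.C ⟪y, (μ : V)⟫ + ∑ j ∈ posRoots b,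
    MvPolynomial.X (Quotient.mk (MulAction.orbitRel P.weylGroupToPerm.range ι) j) *
      MvPolynomial.C (1 / 2 * ((eps (intPairing P j μ) : ℝ) * ⟪y, P.root j⟫)), ?_, ?_⟩
  · simp [map_sum]
  · rw [pairingExt_tilde, map_add, map_sum, algebraMap_C]
    congr 1
    refine Finset.sum_congr rfl fun j _ => ?_
    rw [map_mul, algebraMap_C, param, map_mul, map_mul, algebraMap_half, map_intCast]

omit [P.IsRootSystem] [P.IsReduced] in
-- `(aᵢ, μ̃)` is a polynomial in the parameters whose constant term is the integer `(aᵢ, μ)`.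
lemma wallValueExt_ne_zero {i : Option b.support} {μ : weightLattice P}
    (hμ : wallValue b β i μ ≠ 0) : wallValueExt b β i μ ≠ 0 := by
  suffices h : ∃ p : MvPolynomial (Param P) ℝ,
      MvPolynomial.constantCoeff p = wallValue b β i μ ∧
        algebraMap (MvPolynomial (Param P) ℝ) (CoeffField P) p = wallValueExt b β i μ by
    obtain ⟨p, hp, hp'⟩ := h
    intro h0
    rw [h0, map_eq_zero_iff _ (IsFractionRing.injective _ _)] at hp'
    rw [hp', map_zero] at hp
    exact hμ (by exact_mod_cast hp.symm)
  cases i with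
  | none =>
    obtain ⟨p, hp, hp'⟩ := exists_algebraMap_eq_pairingExt_tilde (b := b) (-P.coroot β) μ
    refine ⟨1 + p, ?_, ?_⟩
    · rw [map_add, hp, map_one, inner_neg_left, ← intPairing_cast]
      simp only [wallValue]
      push_cast
      ring
    · rw [map_add, hp', map_one, wallValueExt, affPairingExt]
      simp [simpleAff]
  | some k =>
    obtain ⟨p, hp, hp'⟩ := exists_algebraMap_eq_pairingExt_tilde (b := b) (P.coroot k) μ
    refine ⟨p, ?_, ?_⟩
    · rw [hp, ← intPairing_cast]
      rfl
    · rw [hp', wallValueExt, affPairingExt]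
      simp [simpleAff]

/-! ### Uniqueness -/

omit [P.IsRootSystem] [P.IsReduced] [Fintype ι] in
-- `divDiff` has integer matrix entries, so it preserves any module of coefficients.
lemma coeff_divDiff_mem {N : Submodule (MvPolynomial (Param P) ℝ) (CoeffField P)}
    {f : ExpAlgebra P} (hf : ∀ μ, f.coeff μ ∈ N) (j : ι) (μ : weightLattice P) :
    (divDiff P j f).coeff μ ∈ N := by
  classical
  have hexpo : ∀ ν κ : weightLattice P, f.coeff ν * (expo κ : ExpAlgebra P).coeff μ ∈ N := by
    intro ν κ
    rw [expo, AddMonoidAlgebra.coeff_single, Finsupp.single_apply]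
    split_ifs
    · rw [mul_one]; exact hf ν
    · rw [mul_zero]; exact zero_mem N
  rw [divDiff, linExt_apply, Finsupp.sum, AddMonoidAlgebra.coeff_sum, Finsupp.finsetSum_apply]
  refine sum_mem fun ν _ => ?_
  rw [AddMonoidAlgebra.coeff_smul_apply, smul_eq_mul, AddMonoidAlgebra.coeff_sub,
    AddMonoidAlgebra.coeff_sum, AddMonoidAlgebra.coeff_sum, Finsupp.sub_apply,
    Finsupp.finsetSum_apply, Finsupp.finsetSum_apply, mul_sub, Finset.mul_sum, Finset.mul_sum]
  exact sub_mem (sum_mem fun _ _ => hexpo _ _) (sum_mem fun _ _ => hexpo _ _)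

omit [P.IsRootSystem] [P.IsReduced] [Fintype ι] in
lemma coeff_dirDeriv (y : V) (f : ExpAlgebra P) (μ : weightLattice P) :
    (dirDeriv P y f).coeff μ = algebraMap ℝ (CoeffField P) ⟪y, (μ : V)⟫ * f.coeff μ := by
  classical
  induction f using expo_induction with
  | h0 => simp
  | hadd f g hf hg =>
    rw [map_add, AddMonoidAlgebra.coeff_add, AddMonoidAlgebra.coeff_add, Finsupp.add_apply,
      Finsupp.add_apply, hf, hg, mul_add]
  | hexpo c ν =>
    rw [map_smul, dirDeriv, linExt_expo]
    simp only [AddMonoidAlgebra.coeff_smul_apply, smul_eq_mul]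
    rw [expo, AddMonoidAlgebra.coeff_single, Finsupp.single_apply]
    split_ifs with h
    · rw [h]; ring
    · simp

omit [P.IsRootSystem] [P.IsReduced] in
/-- A joint eigenvector of the Cherednik operators for `μ̃` is determined by its coefficient
at `e^μ`. -/
lemma eq_zero_of_coeff_eq_zero {lam : weightLattice P} {f : ExpAlgebra P}
    (hf : ∀ y, cherednik b y f = pairingExt P y (tilde b lam) • f) (h0 : f.coeff lam = 0) :
    f = 0 := by
  classical
  let A := MvPolynomial (Param P) ℝ
  -- `N` is the finitely generated module of all coefficients of `f`, and `m` is the maximal ideal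
  -- of the point `k = 0`.
  let N : Submodule A (CoeffField P) :=
    Submodule.span A (f.coeff.support.image f.coeff : Finset (CoeffField P))
  let m : Ideal A := RingHom.ker (MvPolynomial.constantCoeff : A →+* ℝ)
  have hfN : ∀ μ, f.coeff μ ∈ N := by
    intro μ
    by_cases hμ : f.coeff μ = 0
    · rw [hμ]; exact zero_mem N
    · exact Submodule.subset_span (Finset.mem_coe.2 (Finset.mem_image_of_mem _
        (Finsupp.mem_support_iff.2 hμ)))
  have hreal : ∀ (r : ℝ) (N' : Submodule A (CoeffField P)) (x : CoeffField P), x ∈ N' →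
      algebraMap ℝ (CoeffField P) r * x ∈ N' := by
    intro r N' x hx
    have := N'.smul_mem (MvPolynomial.C r) hx
    rwa [Algebra.smul_def, algebraMap_C] at this
  have hparam : ∀ (j : ι) (x : CoeffField P), x ∈ N → param P j * x ∈ m • N := by
    intro j x hx
    have : (MvPolynomial.X (Quotient.mk (MulAction.orbitRel P.weylGroupToPerm.range ι) j) : A) ∈
        m := by
      simp [m, RingHom.mem_ker]
    have := Submodule.smul_mem_smul this hx
    rwa [Algebra.smul_def] at this
  -- Modulo `m`, the eigenvalue equation at `e^μ` reads `(y, μ - λ) f_μ = 0`; the choice `y = μ - λ`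
  -- gives a nonzero real factor to divide by.
  have hle : N ≤ m • N := by
    refine Submodule.span_le.2 fun x hx => ?_
    obtain ⟨μ, hμ, rfl⟩ := Finset.mem_image.1 (Finset.mem_coe.1 hx)
    have hne : μ ≠ lam := by
      rintro rfl
      exact Finsupp.mem_support_iff.1 hμ h0
    set y : V := (μ : V) - lam with hy
    have hyne : ⟪y, y⟫ ≠ 0 := by
      rw [inner_self_ne_zero]
      exact fun h => hne (Subtype.ext (sub_eq_zero.1 h))
    have heq := congrArg (fun g => AddMonoidAlgebra.coeff g μ) (hf y)
    simp only [cherednik_apply, AddMonoidAlgebra.coeff_add, AddMonoidAlgebra.coeff_sum,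
      Finsupp.add_apply, Finsupp.finsetSum_apply, coeff_dirDeriv,
      AddMonoidAlgebra.coeff_smul_apply, AddMonoidAlgebra.coeff_sub, Finsupp.sub_apply,
      smul_eq_mul, pairingExt_tilde, add_mul, Finset.sum_mul] at heq
    have hy2 : ⟪y, y⟫ = ⟪y, (μ : V)⟫ - ⟪y, (lam : V)⟫ := by rw [← inner_sub_right]
    have h1 : algebraMap ℝ (CoeffField P) ⟪y, y⟫ * f.coeff μ ∈ m • N := by
      rw [hy2, map_sub, sub_mul]
      have : algebraMap ℝ (CoeffField P) ⟪y, (μ : V)⟫ * f.coeff μ -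
          algebraMap ℝ (CoeffField P) ⟪y, (lam : V)⟫ * f.coeff μ = _ :=
        sub_eq_sub_iff_add_eq_add.2 (heq.trans (add_comm _ _))
      rw [this]
      refine sub_mem (sum_mem fun j _ => ?_) (sum_mem fun j _ => ?_)
      · rw [mul_assoc]
        refine hparam j _ ?_
        have := hreal (1 / 2 * (eps (intPairing P j lam) * ⟪y, P.root j⟫)) N _ (hfN μ)
        rwa [map_mul, map_mul, algebraMap_half, map_intCast] at this
      · refine hparam j _ (hreal _ _ _ (sub_mem (coeff_divDiff_mem hfN j μ) ?_))
        have := hreal (1 / 2) N _ (hfN μ)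
        rwa [algebraMap_half] at this
    have h2 := hreal ⟪y, y⟫⁻¹ _ _ h1
    rw [← mul_assoc, ← map_mul, inv_mul_cancel₀ hyne, map_one, one_mul] at h2
    exact h2
  -- Nakayama without a local ring: some `r ≡ 1` modulo `m` kills `N`. As `r ≠ 0` and `N` lies in a
  -- field containing `A`, all coefficients vanish.
  obtain ⟨r, hr, hrN⟩ := Submodule.exists_sub_one_mem_and_smul_eq_zero_of_fg_of_le_smul m N
    ⟨_, rfl⟩ hle
  have hr0 : r ≠ 0 := by
    rintro rfl
    simp [m, RingHom.mem_ker] at hr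
  apply AddMonoidAlgebra.coeff_injective
  ext μ
  have := hrN _ (hfN μ)
  rw [Algebra.smul_def, mul_eq_zero, map_eq_zero_iff _ (IsFractionRing.injective _ _)] at this
  simpa using this.resolve_left hr0

/-! ### The product formula -/

/-- The product `(s_{iₘ} + cₘ) ⋯ (s_{i₁} + c₁)` of intertwiners. -/
def intertwiner (b : P.Base) (β : ι) (l : List (Option b.support)) (ν : weightLattice P) :
    Module.End (CoeffField P) (ExpAlgebra P) :=
  (List.ofFn fun j : Fin l.length => reflOp b β (l.get j) + coef b β l ν j • 1).reverse.prod

omit [P.IsRootSystem] [P.IsReduced] in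
-- The product is reversed, so the head of the word acts first and the tail then starts from the
-- reflected weight.
lemma intertwiner_cons_apply (β : ι) (i : Option b.support) (l : List (Option b.support))
    (ν : weightLattice P) (f : ExpAlgebra P) :
    intertwiner b β (i :: l) ν f = intertwiner b β l (reflWeight b β i ν)
      (reflOp b β i f + (simpleParam b β i * (wallValueExt b β i ν)⁻¹) • f) := by
  have h : intertwiner b β (i :: l) ν = intertwiner b β l (reflWeight b β i ν) *
      (reflOp b β i + (simpleParam b β i * (wallValueExt b β i ν)⁻¹) • 1) := by
    rw [intertwiner]
    refine (congrArg (fun L => (List.reverse L).prod) (List.ofFn_succ ..)).trans ?_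
    rw [List.reverse_cons, List.prod_append, List.prod_singleton]
    rfl
  rw [h]; rfl

/-- Invariant of the successive application of intertwiners: `f` is a joint eigenvector for `ν`
and equals `e^ν` up to exponentials of other weights whose level is at most that of `ν`. -/
structure IsLevelTriangular (b : P.Base) (ν : weightLattice P) (f : ExpAlgebra P) : Prop where
  isNonsymmetric : IsNonsymmetricHeckmanOpdam b ν f
  coeff_eq_zero : ∀ μ, level b ν < level b μ → f.coeff μ = 0

lemma IsLevelTriangular.intertwiner_step (hβ : IsHighestShort b β) {i : Option b.support}
    {ν : weightLattice P} (hν : 0 < wallValue b β i ν) {f : ExpAlgebra P}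
    (hf : IsLevelTriangular b ν f) :
    IsLevelTriangular b (reflWeight b β i ν)
      (reflOp b β i f + (simpleParam b β i * (wallValueExt b β i ν)⁻¹) • f) := by
  have hlev := level_reflWeight hβ i ν
  rw [Int.sign_eq_one_of_pos hν] at hlev
  have hcoeff : ∀ μ, (reflOp b β i f +
      (simpleParam b β i * (wallValueExt b β i ν)⁻¹) • f).coeff μ =
        f.coeff (reflWeight b β i μ) +
          (simpleParam b β i * (wallValueExt b β i ν)⁻¹) * f.coeff μ := by
    intro μ
    rw [AddMonoidAlgebra.coeff_add, Finsupp.add_apply, coeff_reflOp,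
      AddMonoidAlgebra.coeff_smul_apply, smul_eq_mul]
  refine ⟨⟨?_, cherednik_intertwiner hβ hν.ne' (wallValueExt_ne_zero hν.ne')
    hf.isNonsymmetric.2⟩, fun μ hμ => ?_⟩
  -- The coefficient at `sᵢ ν` is `f_ν + c f_{sᵢ ν}`; the second term vanishes because `sᵢ ν` has
  -- higher level than `ν`.
  · rw [hcoeff, reflWeight_reflWeight, hf.isNonsymmetric.1,
      hf.coeff_eq_zero (reflWeight b β i ν) (by omega), mul_zero, add_zero]
  · have := level_reflWeight_le hβ i (reflWeight b β i μ)
    rw [reflWeight_reflWeight] at this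
    rw [hcoeff, hf.coeff_eq_zero μ (by omega), hf.coeff_eq_zero (reflWeight b β i μ) (by omega),
      mul_zero, add_zero]

/-- If the total rise equals the number of letters, then no letter can rise by less than one. -/
lemma wallValue_pos_of_level (hβ : IsHighestShort b β) {i : Option b.support}
    {l : List (Option b.support)} {ν : weightLattice P}
    (h : level b (partialWeight b β (i :: l) ν (i :: l).length) =
      level b ν + (i :: l).length) :
    0 < wallValue b β i ν ∧
      level b (partialWeight b β l (reflWeight b β i ν) l.length) =
        level b (reflWeight b β i ν) + l.length := by
  rw [List.length_cons, partialWeight_cons] at h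
  have h1 := level_partialWeight_le hβ l (reflWeight b β i ν)
  have h2 := level_reflWeight hβ i ν
  push_cast at h
  have h3 : 0 < (wallValue b β i ν).sign := by omega
  have h4 : 0 < wallValue b β i ν := Int.sign_pos_iff.1 h3
  rw [Int.sign_eq_one_of_pos h4] at h2
  exact ⟨h4, by omega⟩

lemma IsLevelTriangular.intertwiner (hβ : IsHighestShort b β) {l : List (Option b.support)}
    {ν : weightLattice P} (h : level b (partialWeight b β l ν l.length) = level b ν + l.length)
    {f : ExpAlgebra P} (hf : IsLevelTriangular b ν f) :
    (∀ j, denom b β l ν j ≠ 0) ∧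
      IsLevelTriangular b (partialWeight b β l ν l.length) (intertwiner b β l ν f) := by
  induction l generalizing ν f with
  | nil => exact ⟨fun j => j.elim0, hf⟩
  | cons i l ih =>
    obtain ⟨hpos, h'⟩ := wallValue_pos_of_level hβ h
    obtain ⟨hd, ht⟩ := ih h' (hf.intertwiner_step hβ hpos)
    refine ⟨fun j => ?_, ?_⟩
    · refine Fin.cases ?_ (fun j => ?_) j
      · exact wallValueExt_ne_zero hpos.ne'
      · exact hd j
    · rw [intertwiner_cons_apply]
      exact ht

end Spectrum

end HeckmanOpdam

end

open HeckmanOpdam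
theorem corollary5p2 {ι V : Type*} [Fintype ι] [NormedAddCommGroup V] [InnerProductSpace ℝ V]
    (P : RootPairing ι ℝ V V) [P.IsRootSystem] [P.IsCrystallographic] [P.IsReduced]
    [P.IsIrreducible] [IsEuclidean P]
    (b : P.Base) (β : ι) (hβ : IsHighestShort b β) (lam : weightLattice P) :
    (∃ w, IsShortestToMinuscule b β (lam : V) w) ∧
    ∀ w, IsShortestToMinuscule b β (lam : V) w →
      ∀ l : List (Option b.support), IsReducedExpression b β l w →
        ∀ lamBar : weightLattice P, (lamBar : V) = w lam →
          (∀ j, denom b β l lamBar j ≠ 0) ∧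
          ∀ f : ExpAlgebra P, IsNonsymmetricHeckmanOpdam b lam f ↔
            f = intertwinerProduct b β l lamBar := by
  refine ⟨exists_isShortestToMinuscule hβ lam, fun w hw l hl lamBar hbar => ?_⟩
  obtain ⟨h0, h1, h2⟩ := level_eq_length_of_isReducedExpression hβ hw hl hbar
  have hbase : IsLevelTriangular b lamBar (expo lamBar) := by
    refine ⟨⟨by simp [expo], cherednik_expo_of_minuscule h0⟩, fun μ hμ => ?_⟩
    rw [expo, AddMonoidAlgebra.coeff_single, Finsupp.single_apply_eq_zero]
    rintro rfl
    exact absurd hμ (lt_irrefl _)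
  obtain ⟨hd, ht⟩ := hbase.intertwiner hβ (l := l) (by rw [h1, h2, h0, zero_add])
  rw [h1] at ht
  refine ⟨hd, fun f => ⟨fun hf => ?_, ?_⟩⟩
  · change f = intertwiner b β l lamBar (expo lamBar)
    -- The difference of two normalized eigenvectors for the same weight has zero coefficient there,
    -- so it vanishes.
    rw [← sub_eq_zero]
    refine eq_zero_of_coeff_eq_zero (b := b) (lam := lam) (fun y => ?_) ?_
    · rw [map_sub, hf.2, ht.isNonsymmetric.2, smul_sub]
    · rw [AddMonoidAlgebra.coeff_sub, Finsupp.sub_apply, hf.1, ht.isNonsymmetric.1, sub_self]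
  · rintro rfl
    exact ht.isNonsymmetric
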